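/- All matrices have entries in $\{0,1\}$. A matrix is simple if it has no repeated columns. A matrix $F$ is a configuration in $A$ if some submatrix of $A$ is a row and column permutation of $F$. Let $\mathrm{Avoid}(m,F)$ be the set of simple $m$-rowed matrices with no configuration $F$, let $\mathrm{forb}(m,F)$ be the maximum number of columns of a matrix in $\mathrm{Avoid}(m,F)$, and let $\mathrm{Ext}(m,F)$ be the set of matrices in $\mathrm{Avoid}(m,F)$ with exactly $\mathrm{forb}(m,F)$ columns. Let $F(0,6,1,0)$ be the $2\times 7$ matrix consisting of six columns $\binom{1}{0}$ and one column $\binom{0}{1}$. Let $K_k^s$ be the $k\times\binom{k}{s}$ matrix of all columns of sum $s$. Let $G_5$ be the $5\times5$ vertex-edge incidence matrix of a cycle on 5 vertices, $G_5'$ that of the complementary 5-cycle, and let $(G_5')^c$ be obtained from $G_5'$ by exchanging 0 and 1. Theorem. (i) For every $m$, $\mathrm{forb}(m,F(0,6,1,0))\le\lfloor\frac{21}{5}m\rfloor+1$, with equality if and only if $m\equiv0\pmod 5$. (ii) If $m\equiv1\pmod 5$ and $m\ge6$, then $\mathrm{forb}(m,F(0,6,1,0))=\lfloor\frac{21}{5}m\rfloor$.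 (iii) Consider the three $5\times 21$ matrices $$[K_5^4\,K_5^2\,K_5^1\,K_5^0],\qquad [K_5^4\,K_5^3\,K_5^1\,K_5^0],\qquad [K_5^4\,G_5\,(G_5')^c\,K_5^1\,K_5^0],$$ no two of which agree up to row and column permutations. If $m=5t$, then a matrix $A$ with $m$ rows is in $\mathrm{Ext}(m,F(0,6,1,0))$ if and only if, up to a permutation of rows and of columns, it is $$\begin{bmatrix}B_1&\mathbf 1&\mathbf 1&\cdots&\mathbf 1&\mathbf 1\\ \mathbf 0&B_2&\mathbf 1&\cdots&\mathbf 1&\mathbf 1\\ \mathbf 0&\mathbf 0&B_3&\cdots&\mathbf 1&\mathbf 1\\ \vdots&\vdots&&\ddots&\vdots&\vdots\\ \mathbf 0&\mathbf 0&\mathbf 0&\cdots&B_t&\mathbf 1\end{bmatrix},$$ where each $B_i$ is, up to row and column permutations, one of these three matrices; here $\mathbf 1$ and $\mathbf 0$ denote blocks with all entries 1, respectively 0, and the last block column is a single column of 1's. -/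

import Mathlib

namespace ForbConf

/-- `F` is a configuration in `A`: some submatrix of `A` is a row and column permutation of `F`. -/
def IsConfig {R C R' C' : Type*} (F : Matrix R C (Fin 2)) (A : Matrix R' C' (Fin 2)) : Prop :=
  ∃ (r : R ↪ R') (c : C ↪ C'), A.submatrix r c = F

/-- A (0,1)-matrix is simple if it has no repeated columns. -/
def IsSimple {R C : Type*} (A : Matrix R C (Fin 2)) : Prop :=
  ∀ j j' : C, (∀ i, A i j = A i j') → j = j'

/-- The simple `m`-rowed (0,1)-matrices with `n` columns and no configuration `F`. -/
def Avoid {R C : Type*} (m n : ℕ) (F : Matrix R C (Fin 2)) :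
    Set (Matrix (Fin m) (Fin n) (Fin 2)) :=
  {A | IsSimple A ∧ ¬ IsConfig F A}

/-- The maximum number of columns of a simple `m`-rowed (0,1)-matrix with no configuration `F`. -/
noncomputable def forb {R C : Type*} (m : ℕ) (F : Matrix R C (Fin 2)) : ℕ :=
  sSup {n | (Avoid m n F).Nonempty}

/-- An extremal matrix: a member of `Avoid` with the maximum number of columns. -/
def IsExtremal {R C : Type*} {m n : ℕ} (F : Matrix R C (Fin 2))
    (A : Matrix (Fin m) (Fin n) (Fin 2)) : Prop :=
  A ∈ Avoid m n F ∧ n = forb m F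

/-- The supremum defining `forb` is over a bounded set. -/
theorem bddAbove_avoid {R C : Type*} (m : ℕ) (F : Matrix R C (Fin 2)) :
    BddAbove {n | (Avoid m n F).Nonempty} := by
  refine ⟨2 ^ m, ?_⟩
  rintro n ⟨A, hA, -⟩
  have h : Function.Injective (fun (j : Fin n) (i : Fin m) => A i j) :=
    fun j j' hj => hA j j' (fun i => congrFun hj i)
  simpa using Fintype.card_le_of_injective _ h

/-- The supremum defining `forb` is attained as soon as `F` has a column. -/
theorem forb_isGreatest {R C : Type*} [Nonempty C] (m : ℕ) (F : Matrix R C (Fin 2)) :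
    IsGreatest {n | (Avoid m n F).Nonempty} (forb m F) := by
  refine ⟨Nat.sSup_mem ⟨0, ?_⟩ (bddAbove_avoid m F), fun n hn => le_csSup (bddAbove_avoid m F) hn⟩
  refine ⟨fun _ j => j.elim0, fun j => j.elim0, ?_⟩
  rintro ⟨-, c, -⟩
  exact (c (Classical.arbitrary C)).elim0

/-- `F(0,p,1,0)`: the `2 × (p+1)` matrix with `p` columns `(1,0)ᵀ` followed by one column
`(0,1)ᵀ`. -/
def F0p10 (p : ℕ) : Matrix (Fin 2) (Fin (p + 1)) (Fin 2) :=
  Matrix.of fun i j => if i = 0 then (if (j : ℕ) < p then 1 else 0)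
    else (if (j : ℕ) < p then 0 else 1)

/-- Two (0,1)-matrices agree up to row and column permutations. -/
def PermEquiv {R C R' C' : Type*} (A : Matrix R C (Fin 2)) (B : Matrix R' C' (Fin 2)) : Prop :=
  ∃ (r : R ≃ R') (c : C ≃ C'), A = B.submatrix r c

/-- `K_k^s`: all (0,1)-columns on `k` rows with column sum `s`. -/
def K (k s : ℕ) : Matrix (Fin k) {S : Finset (Fin k) // S.card = s} (Fin 2) :=
  Matrix.of fun i S => if i ∈ S.1 then 1 else 0

open Classical in
/-- The vertex-edge incidence matrix of a graph. -/
noncomputable def incidence {V : Type*} (G : SimpleGraph V) : Matrix V G.edgeSet (Fin 2) :=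
  Matrix.of fun v e => if v ∈ e.1 then 1 else 0

/-- The (0,1)-complement of a matrix. -/
def complement01 {R C : Type*} (A : Matrix R C (Fin 2)) : Matrix R C (Fin 2) :=
  Matrix.of fun i j => if A i j = 0 then 1 else 0

/-- `[G₅ (G₅')ᶜ]`, with `G₅` the incidence matrix of the 5-cycle and `G₅'` the incidence matrix
of the complementary 5-cycle. -/
noncomputable def cyclePair : Matrix (Fin 5)
    ((SimpleGraph.cycleGraph 5).edgeSet ⊕ ((SimpleGraph.cycleGraph 5)ᶜ).edgeSet) (Fin 2) :=
  Matrix.fromCols (incidence (SimpleGraph.cycleGraph 5))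
    (complement01 (incidence (SimpleGraph.cycleGraph 5)ᶜ))

/-- `[K_5^4 M K_5^1 K_5^0]`. -/
def block {C : Type*} (M : Matrix (Fin 5) C (Fin 2)) :=
  Matrix.fromCols (K 5 4) (Matrix.fromCols M (Matrix.fromCols (K 5 1) (K 5 0)))

/-- The block construction: the diagonal blocks are `B 0, …, B (t-1)`, all entries above the
diagonal blocks are `1`, all entries below are `0`, and there is one further column of `1`s
(indexed by `none`). -/
def construction {t k l : ℕ} (B : Fin t → Matrix (Fin k) (Fin l) (Fin 2)) :
    Matrix (Fin t × Fin k) (Option (Fin t × Fin l)) (Fin 2) :=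
  Matrix.of fun i j => match j with
    | none => 1
    | some j => if i.1 = j.1 then B i.1 i.2 j.2 else if i.1 < j.1 then 1 else 0

end ForbConf

open ForbConf

/-! Replace each column by its support. Avoiding the configuration means: if some set contains `i`
and misses `j`, then at most five sets contain `j` and miss `i` (`Balanced`).

Call a nonempty `U` dominating if every set with an element outside `U` contains `U`. A minimal
dominating `U` splits the family into the sets not containing `U`, which lie inside `U` and form an
`Indecomposable` family, and the sets containing `U`, which form a balanced family on the remaining
points. On `k` points the first part has at most `21k/5 - 1` members, unless `k = 5` and it is one
of three families of 21 sets (`Indecomposable.block`). Induction (`card_le_or_tower`) gives `21m/5`,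
except when every piece is exceptional: then the full set, left over at the very end, yields `21m/5
+ 1`, and the family is a `Tower`.

For the indecomposable bound, suppose first that all degrees differ by at most 10. Then each pair of
points is separated by at most ten sets, and double counting the separated pairs bounds the family.
If degrees spread further, indecomposability forbids large gaps in the degree sequence, while the
sets containing a point of least degree and those missing a point of greatest degree are few
(`card_add_two_le_of_spread`).

Equality on five points forces all 1-sets and 4-sets, and exactly five separations for each ordered
pair. The 2-sets then form a regular graph and the 3-sets are the complements of its non-edges. A
regular graph on five vertices is complete, empty or a 5-cycle, whence the three blocks.

Stacking blocks gives the lower bound; for `m ≡ 1 (mod 5)` a six-point family of 25 sets is put at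
the bottom. -/

namespace ForbConf

open Finset

/-! ### Indecomposable balanced families: the size bound -/

section Core

variable {R : Type*} [DecidableEq R]

/-- The number of members of `𝒜` containing `i` but not `j`. -/
def sep (𝒜 : Finset (Finset R)) (i j : R) : ℕ := #{A ∈ 𝒜 | i ∈ A ∧ j ∉ A}

/-- The number of members of `𝒜` containing `i`. -/
def deg (𝒜 : Finset (Finset R)) (i : R) : ℕ := #{A ∈ 𝒜 | i ∈ A}

/-- The set-family form of avoiding the configuration `F(0,6,1,0)`. -/
def Balanced (𝒜 : Finset (Finset R)) : Prop := ∀ i j, sep 𝒜 i j ≠ 0 → sep 𝒜 j i ≤ 5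

/-- Both sides count the sets meeting `{i, j}`. Hence a difference of degrees is a difference of
separation numbers. -/
theorem sep_add_deg (𝒜 : Finset (Finset R)) (i j : R) :
    sep 𝒜 i j + deg 𝒜 j = sep 𝒜 j i + deg 𝒜 i := by
  have h (i j : R) : sep 𝒜 i j + #{A ∈ 𝒜 | i ∈ A ∧ j ∈ A} = deg 𝒜 i := by
    rw [sep, deg, ← card_union_of_disjoint]
    · congr 1
      ext A
      simp only [mem_union, mem_filter]
      tauto
    · rw [disjoint_filter]
      tauto
  have h1 := h i j
  have h2 := h j i
  have h3 : #{A ∈ 𝒜 | i ∈ A ∧ j ∈ A} = #{A ∈ 𝒜 | j ∈ A ∧ i ∈ A} := by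
    congr 1
    ext A
    simp only [mem_filter]
    tauto
  omega

theorem sep_ne_zero {𝒜 : Finset (Finset R)} {i j : R} :
    sep 𝒜 i j ≠ 0 ↔ ∃ A ∈ 𝒜, i ∈ A ∧ j ∉ A := by
  rw [sep, Ne, card_eq_zero, ← Ne, ← nonempty_iff_ne_empty]
  simp [Finset.Nonempty]

theorem sum_card_eq_sum_deg {𝒞 : Finset (Finset R)} {I : Finset R} (h : ∀ C ∈ 𝒞, C ⊆ I) :
    ∑ C ∈ 𝒞, #C = ∑ j ∈ I, deg 𝒞 j := by
  simp only [deg, card_filter]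
  rw [sum_comm]
  refine sum_congr rfl fun C hC => ?_
  rw [← card_filter]
  congr 1
  ext j
  simpa using fun hj => h C hC hj

theorem card_singletons_le {R : Type*} {𝒞 : Finset (Finset R)} {I : Finset R} (h : ∀ C ∈ 𝒞, C ⊆ I) :
    #{C ∈ 𝒞 | #C = 1} ≤ #I := by
  have : #(I.powersetCard 1) = #I := by simp
  rw [← this]
  refine card_le_card fun C hC => ?_
  rw [mem_filter] at hC
  exact mem_powersetCard.2 ⟨h C hC.1, hC.2⟩

/-- Only singletons have size below 2, so `2 * #𝒞 ≤ 5 * #I + #I`, that is `#𝒞 ≤ 3 * #I`. This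
suffices from `#I = 3` on; for one or two points `2 ^ #I - 1` does. -/
theorem card_add_three_le {𝒞 : Finset (Finset R)} {I : Finset R} (h : ∀ C ∈ 𝒞, C ⊆ I)
    (hne : ∅ ∉ 𝒞) (hI : I.Nonempty) (hdeg : ∀ j ∈ I, deg 𝒞 j ≤ 5) :
    #𝒞 + 3 ≤ 4 * #I := by
  have h1 := card_singletons_le h
  have h2 : ∑ C ∈ 𝒞, #C ≤ 5 * #I := by
    rw [sum_card_eq_sum_deg h]
    calc _ ≤ ∑ j ∈ I, 5 := sum_le_sum hdeg
      _ = _ := by simp [mul_comm]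
  have h3 : 2 * #𝒞 ≤ ∑ C ∈ 𝒞, #C + #{C ∈ 𝒞 | #C = 1} := by
    rw [card_filter, ← sum_add_distrib, mul_comm, ← smul_eq_mul, ← sum_const]
    refine sum_le_sum fun C hC => ?_
    have : #C ≠ 0 := fun h0 => hne (card_eq_zero.1 h0 ▸ hC)
    split_ifs <;> omega
  have h4 : #𝒞 + 1 ≤ 2 ^ #I := by
    rw [← card_powerset, ← card_insert_of_notMem hne]
    refine card_le_card fun C hC => ?_
    rcases mem_insert.1 hC with rfl | hC
    · simp
    · exact mem_powerset.2 (h C hC)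
  have h5 := hI.card_pos
  by_cases h6 : 3 ≤ #I
  · omega
  · interval_cases h : #I <;> omega

/-- No proper nonempty part of `U` is dominating all of the rest of `U`. -/
def Indecomposable (U : Finset R) (𝒜 : Finset (Finset R)) : Prop :=
  ∀ V ⊆ U, V.Nonempty → V ≠ U → ∃ i ∈ U \ V, ∃ j ∈ V, sep 𝒜 i j ≠ 0

/-- The points of degree above `v` do not dominate the rest, so some low `i` is separated from some
high `j`. Balance gives `sep 𝒩 j i ≤ 5`, and the degree difference is at most `5 - 1`. Degrees
therefore have no gap longer than 4. -/
theorem Indecomposable.exists_window {U : Finset R} {𝒩 : Finset (Finset R)}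
    (hind : Indecomposable U 𝒩) (hbal : Balanced 𝒩) {x y : R} (hx : x ∈ U) (hy : y ∈ U) {v : ℕ}
    (hxv : deg 𝒩 x ≤ v) (hvy : v < deg 𝒩 y) :
    ∃ i ∈ U, ∃ j ∈ U, deg 𝒩 i ≤ v ∧ v < deg 𝒩 j ∧ deg 𝒩 j ≤ deg 𝒩 i + 4 ∧ sep 𝒩 i j ≠ 0 := by
  obtain ⟨i, hi, j, hj, hs⟩ := hind {j ∈ U | v < deg 𝒩 j} (filter_subset _ _)
    ⟨y, by simp [hy, hvy]⟩ (fun h => by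
      have := filter_eq_self.1 h x hx
      omega)
  simp only [mem_sdiff, mem_filter, not_and, not_lt] at hi hj
  have h1 := sep_add_deg 𝒩 i j
  have h2 := hi.2 hi.1
  have h3 := hbal i j hs
  exact ⟨i, hi.1, j, hj.1, h2, hj.2, by omega, hs⟩

/-- The sets containing `x`, of least degree, have complements inside a small set `I`; those missing
`y`, of greatest degree, lie inside a small set `J`. Both are counted by `card_add_three_le`. The
remaining `deg 𝒩 y - deg 𝒩 x` is paid for by the points of intermediate degree. -/
theorem card_add_two_le_of_spread {U : Finset R} {𝒩 : Finset (Finset R)}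
    (hsub : ∀ A ∈ 𝒩, A ⊆ U) (hne : ∅ ∉ 𝒩) (hU : U ∉ 𝒩)
    (hind : Indecomposable U 𝒩) (hbal : Balanced 𝒩) {x₀ y₀ : R} (hx₀ : x₀ ∈ U) (hy₀ : y₀ ∈ U)
    (hmin : ∀ i ∈ U, deg 𝒩 x₀ ≤ deg 𝒩 i) (hmax : ∀ i ∈ U, deg 𝒩 i ≤ deg 𝒩 y₀)
    (hspread : deg 𝒩 x₀ + 11 ≤ deg 𝒩 y₀) : #𝒩 + 2 ≤ 4 * #U := by
  -- The extreme thresholds replace `x₀`, `y₀` by points of the same degree for which `I` and `J`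
  -- are nonempty.
  obtain ⟨x, hx, x', hx', hxd, -, -, hxs⟩ :=
    hind.exists_window hbal hx₀ hy₀ le_rfl (by omega : deg 𝒩 x₀ < deg 𝒩 y₀)
  obtain ⟨y', hy', y, hy, -, hyd, -, hys⟩ :=
    hind.exists_window hbal hx₀ hy₀ (by omega : deg 𝒩 x₀ ≤ deg 𝒩 y₀ - 1) (by omega)
  have hdx : deg 𝒩 x = deg 𝒩 x₀ := le_antisymm hxd (hmin x hx)
  have hdy : deg 𝒩 y = deg 𝒩 y₀ := le_antisymm (hmax y hy) (by omega)
  set I : Finset R := {j ∈ U | sep 𝒩 x j ≠ 0} with hI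
  set J : Finset R := {j ∈ U | sep 𝒩 j y ≠ 0} with hJ
  have hIx : ∀ j ∈ I, sep 𝒩 x j ≤ 5 ∧ deg 𝒩 j ≤ deg 𝒩 x₀ + 4 := by
    intro j hj
    rw [hI, mem_filter] at hj
    have h1 := sep_add_deg 𝒩 x j
    have h2 := hmin j hj.1
    have h3 := hbal x j hj.2
    have h4 := hbal j x (by omega)
    omega
  have hJy : ∀ j ∈ J, sep 𝒩 j y ≤ 5 ∧ deg 𝒩 y₀ ≤ deg 𝒩 j + 4 := by
    intro j hj
    rw [hJ, mem_filter] at hj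
    have h1 := sep_add_deg 𝒩 j y
    have h2 := hmax j hj.1
    have h3 := hbal j y hj.2
    have h4 := hbal y j (by omega)
    omega
  have hxI : x ∉ I := by simp [hI, sep]
  have hyJ : y ∉ J := by simp [hJ, sep]
  -- the number of sets containing `x`
  have hlow : deg 𝒩 x + 3 ≤ 4 * #I := by
    have hinj : Set.InjOn (fun A => U \ A) (({A ∈ 𝒩 | x ∈ A} : Finset (Finset R)) : Set (Finset R)) := by
      intro A hA B hB hAB
      simp only [coe_filter, Set.mem_ofPred_eq] at hA hB
      rw [← Finset.sdiff_sdiff_eq_self (hsub A hA.1), ← Finset.sdiff_sdiff_eq_self (hsub B hB.1)]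
      exact congrArg (U \ ·) hAB
    have hcard : deg 𝒩 x = #(({A ∈ 𝒩 | x ∈ A}).image (fun A => U \ A)) :=
      (card_image_of_injOn hinj).symm
    rw [hcard]
    refine card_add_three_le ?_ ?_ ⟨x', by simp [hI, hx', hxs]⟩ ?_
    · intro C hC j hj
      obtain ⟨A, hA, rfl⟩ := mem_image.1 hC
      rw [mem_filter] at hA
      rw [mem_sdiff] at hj
      exact mem_filter.2 ⟨hj.1, sep_ne_zero.2 ⟨A, hA.1, hA.2, hj.2⟩⟩
    · intro h
      obtain ⟨A, hA, h⟩ := mem_image.1 h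
      rw [mem_filter] at hA
      have : A = U := subset_antisymm (hsub A hA.1) (sdiff_eq_empty_iff_subset.1 h)
      exact hU (this ▸ hA.1)
    · intro j hj
      refine le_trans ?_ (hIx j hj).1
      rw [deg, sep, filter_image]
      refine card_image_le.trans (card_le_card fun A hA => ?_)
      simp only [mem_filter, mem_sdiff] at hA ⊢
      tauto
  have hhigh : #𝒩 + 3 ≤ deg 𝒩 y + 4 * #J := by
    have hcard : #𝒩 = deg 𝒩 y + #{A ∈ 𝒩 | y ∉ A} := (card_filter_add_card_filter_not _).symm
    have : #{A ∈ 𝒩 | y ∉ A} + 3 ≤ 4 * #J := by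
      refine card_add_three_le ?_ (fun h => hne (mem_filter.1 h).1) ⟨y', by simp [hJ, hy', hys]⟩ ?_
      · intro A hA j hj
        rw [mem_filter] at hA
        exact mem_filter.2 ⟨hsub A hA.1 hj, sep_ne_zero.2 ⟨A, hA.1, hj, hA.2⟩⟩
      · intro j hj
        refine le_trans (card_le_card fun A hA => ?_) (hJy j hj).1
        simp only [mem_filter] at hA ⊢
        tauto
    omega
  -- splitting `U` according to the degree
  set M : Finset R := {j ∈ U | deg 𝒩 x₀ + 4 < deg 𝒩 j ∧ deg 𝒩 j + 4 < deg 𝒩 y₀} with hM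
  -- The thresholds `deg 𝒩 x₀ + 4 + 4w` give points in disjoint degree windows of length 4; the map
  -- `(deg - deg 𝒩 x₀ - 5) / 4` recovers `w`.
  have hmid : (deg 𝒩 y₀ - deg 𝒩 x₀ - 9) / 4 ≤ #M := by
    rw [← card_range ((deg 𝒩 y₀ - deg 𝒩 x₀ - 9) / 4)]
    refine le_trans (card_le_card fun w hw => ?_)
      (card_image_le (s := M) (f := fun j => (deg 𝒩 j - deg 𝒩 x₀ - 5) / 4))
    rw [mem_range] at hw
    obtain ⟨i, hi, j, hj, hiv, hvj, hij, -⟩ :=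
      hind.exists_window hbal hx₀ hy₀ (by omega : deg 𝒩 x₀ ≤ deg 𝒩 x₀ + 4 + 4 * w) (by omega)
    exact mem_image.2 ⟨j, mem_filter.2 ⟨hj, by omega, by omega⟩, by omega⟩
  have hdisj1 : Disjoint (insert x I) (insert y J) := by
    rw [disjoint_left]
    intro j h1 h2
    have h3 : deg 𝒩 j ≤ deg 𝒩 x₀ + 4 := by
      rcases mem_insert.1 h1 with rfl | h
      · omega
      · exact (hIx j h).2
    have h4 : deg 𝒩 y₀ ≤ deg 𝒩 j + 4 := by
      rcases mem_insert.1 h2 with rfl | h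
      · omega
      · exact (hJy j h).2
    omega
  have hdisj2 : Disjoint (insert x I ∪ insert y J) M := by
    rw [disjoint_left]
    intro j h1 h2
    rw [hM, mem_filter] at h2
    rcases mem_union.1 h1 with h | h <;> rcases mem_insert.1 h with rfl | h
    · omega
    · have := (hIx j h).2; omega
    · omega
    · have := (hJy j h).2; omega
  have hcardU : #I + 1 + (#J + 1) + #M ≤ #U := by
    rw [← card_insert_of_notMem hxI, ← card_insert_of_notMem hyJ, ← card_union_of_disjoint hdisj1,
      ← card_union_of_disjoint hdisj2]
    refine card_le_card ?_
    rw [union_subset_iff, union_subset_iff, insert_subset_iff, insert_subset_iff]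
    exact ⟨⟨⟨hx, filter_subset _ _⟩, hy, filter_subset _ _⟩, filter_subset _ _⟩
  -- With `D` the degree spread, `#𝒩 + 6 ≤ 4(#I + #J) + D`, `4 * #M ≥ D - 12` and `#I + #J + #M + 2
  -- ≤ #U`.
  omega

theorem sum_card_mul_card_compl {U : Finset R} {𝒩 : Finset (Finset R)} (hsub : ∀ A ∈ 𝒩, A ⊆ U) :
    ∑ A ∈ 𝒩, #A * (#U - #A) = ∑ p ∈ U.offDiag, sep 𝒩 p.1 p.2 := by
  simp only [sep, card_filter]
  rw [sum_comm]
  refine sum_congr rfl fun A hA => ?_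
  rw [← card_sdiff_of_subset (hsub A hA), ← card_product, ← card_filter]
  congr 1
  ext ⟨i, j⟩
  simp only [mem_product, mem_sdiff, mem_filter, mem_offDiag]
  constructor
  · rintro ⟨h1, h2, h3⟩
    exact ⟨⟨hsub A hA h1, h2, fun h => h3 (h ▸ h1)⟩, h1, h3⟩
  · rintro ⟨⟨_, h2, _⟩, h1, h3⟩
    exact ⟨h1, h2, h3⟩

/-- If both numbers are nonzero, each is at most 5; if one vanishes, the other is the degree
difference. -/
theorem Balanced.sep_add_sep_le {𝒩 : Finset (Finset R)} (hbal : Balanced 𝒩) {i j : R}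
    (h1 : deg 𝒩 i ≤ deg 𝒩 j + 10) (h2 : deg 𝒩 j ≤ deg 𝒩 i + 10) :
    sep 𝒩 i j + sep 𝒩 j i ≤ 10 := by
  have h := sep_add_deg 𝒩 i j
  have h3 := hbal i j
  have h4 := hbal j i
  omega

theorem sum_offDiag_swap {R : Type*} (U : Finset R) (f : R → R → ℕ) :
    ∑ p ∈ U.offDiag, f p.2 p.1 = ∑ p ∈ U.offDiag, f p.1 p.2 := by
  refine sum_bij' (fun p _ => p.swap) (fun p _ => p.swap) ?_ ?_ ?_ ?_ ?_ <;>
    simp +contextual [eq_comm]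

theorem sum_sep_le {U : Finset R} {𝒩 : Finset (Finset R)} (hbal : Balanced 𝒩)
    (hclose : ∀ i ∈ U, ∀ j ∈ U, deg 𝒩 j ≤ deg 𝒩 i + 10) :
    ∑ p ∈ U.offDiag, sep 𝒩 p.1 p.2 ≤ 5 * (#U * (#U - 1)) := by
  have h1 : ∑ p ∈ U.offDiag, (sep 𝒩 p.1 p.2 + sep 𝒩 p.2 p.1) ≤ ∑ p ∈ U.offDiag, 10 := by
    refine sum_le_sum fun p hp => ?_
    rw [mem_offDiag] at hp
    exact hbal.sep_add_sep_le (hclose _ hp.2.1 _ hp.1) (hclose _ hp.1 _ hp.2.1)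
  rw [sum_add_distrib, sum_offDiag_swap U (sep 𝒩), sum_const, offDiag_card, smul_eq_mul,
    ← Nat.mul_sub_one] at h1
  omega

theorem card_cosingletons_le {R : Type*} {U : Finset R} {𝒩 : Finset (Finset R)} (hsub : ∀ A ∈ 𝒩, A ⊆ U) :
    #{A ∈ 𝒩 | #A + 1 = #U} ≤ #U := by
  by_cases h : #U = 0
  · rw [card_eq_zero.2] <;> simp [h]
  have : #(U.powersetCard (#U - 1)) = #U := by
    rw [card_powersetCard, Nat.choose_symm (by omega : 1 ≤ #U), Nat.choose_one_right]
  rw [← this]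
  refine card_le_card fun C hC => ?_
  rw [mem_filter] at hC
  exact mem_powersetCard.2 ⟨hsub C hC.1, by omega⟩

/-- With `k = #U`, a set of size `a` separates `a(k - a)` ordered pairs. This equals `k - 1` for `a
= 1` or `k - 1`, and otherwise is at least `2(k - 2)`, since `a(k - a) - 2(k - 2) = (a - 2)(k - a -
2)`. The last term makes up the deficit `k - 3`. -/
theorem le_sum_sep {U : Finset R} {𝒩 : Finset (Finset R)}
    (hsub : ∀ A ∈ 𝒩, A ⊆ U) (hne : ∅ ∉ 𝒩) (hU : U ∉ 𝒩) (hk : 3 ≤ #U) :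
    2 * (#U - 2) * #𝒩 ≤ ∑ p ∈ U.offDiag, sep 𝒩 p.1 p.2 +
      (#U - 3) * (#{A ∈ 𝒩 | #A = 1} + #{A ∈ 𝒩 | #A + 1 = #U}) := by
  rw [← sum_card_mul_card_compl hsub]
  rw [card_filter, card_filter, ← sum_add_distrib, mul_sum, ← sum_add_distrib, mul_comm,
    ← smul_eq_mul, ← sum_const]
  refine sum_le_sum fun A hA => ?_
  have h0 : #A ≠ 0 := fun h0 => hne (card_eq_zero.1 h0 ▸ hA)
  have hlt : #A < #U := card_lt_card ⟨hsub A hA, fun h => hU (subset_antisymm h (hsub A hA) ▸ hA)⟩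
  obtain ⟨b, hb⟩ : ∃ b, #U = #A + b + 1 := ⟨#U - #A - 1, by omega⟩
  obtain ⟨a, ha⟩ : ∃ a, #A = a + 1 := ⟨#A - 1, by omega⟩
  rw [hb, ha]
  simp only [show a + 1 + b + 1 - 2 = a + b by omega, show a + 1 + b + 1 - (a + 1) = b + 1 by omega,
    show a + 1 + b + 1 - 3 = a + b - 1 by omega]
  rcases a with _ | a <;> rcases b with _ | b
  · omega
  · simp; omega
  · simp; omega
  · have : 0 ≤ a * b := Nat.zero_le _
    split_ifs <;> nlinarith

theorem card_le_two_pow {U : Finset R} {𝒩 : Finset (Finset R)}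
    (hsub : ∀ A ∈ 𝒩, A ⊆ U) (hne : ∅ ∉ 𝒩) (hU : U ∉ 𝒩) (hk : U.Nonempty) :
    #𝒩 + 2 ≤ 2 ^ #U := by
  have h : U ∉ insert ∅ 𝒩 := by simp [hU, hk.ne_empty]
  rw [← card_powerset, show #𝒩 + 2 = #𝒩 + 1 + 1 from rfl, ← card_insert_of_notMem hne,
    ← card_insert_of_notMem h]
  refine card_le_card fun C hC => ?_
  simp only [mem_insert] at hC
  rcases hC with rfl | rfl | hC
  · simp
  · simp
  · exact mem_powerset.2 (hsub C hC)

theorem Indecomposable.card_bound {U : Finset R} {𝒩 : Finset (Finset R)}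
    (hsub : ∀ A ∈ 𝒩, A ⊆ U) (hne : ∅ ∉ 𝒩) (hU : U ∉ 𝒩) (hk : U.Nonempty)
    (hind : Indecomposable U 𝒩) (hbal : Balanced 𝒩) :
    5 * (#𝒩 + 2) ≤ 21 * #U ∨
      (#U = 5 ∧ #𝒩 ≤ 20 ∧ ∀ i ∈ U, ∀ j ∈ U, deg 𝒩 j ≤ deg 𝒩 i + 10) := by
  by_cases hclose : ∀ i ∈ U, ∀ j ∈ U, deg 𝒩 j ≤ deg 𝒩 i + 10
  · have h1 := card_le_two_pow hsub hne hU hk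
    have hpos := hk.card_pos
    by_cases h4 : #U ≤ 4
    · left
      interval_cases h : #U <;> omega
    have h2 := (le_sum_sep hsub hne hU (by omega)).trans
      (Nat.add_le_add_right (sum_sep_le hbal hclose) _)
    have h3 := card_singletons_le hsub
    have h5 := card_cosingletons_le hsub
    have h6 : 2 * (#U - 2) * #𝒩 ≤ 5 * (#U * (#U - 1)) + (#U - 3) * (2 * #U) :=
      h2.trans (Nat.add_le_add_left (Nat.mul_le_mul_left _ (by omega)) _)
    -- The estimate is `2(k - 2) * #𝒩 ≤ k(7k - 11)`. For `k = 5, 6, 7` it allows 20, 23, 26 sets,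
    -- where the first alternative needs 19, 23, 27; only `k = 5` fails.
    by_cases h7 : #U ≤ 7
    · interval_cases h : #U
      · right
        exact ⟨rfl, by omega, hclose⟩
      · left; omega
      · left; omega
    · left
      obtain ⟨l, hl⟩ : ∃ l, #U = l + 3 := ⟨#U - 3, by omega⟩
      rw [hl] at h6 h7 ⊢
      simp only [show l + 3 - 2 = l + 1 by omega, show l + 3 - 1 = l + 2 by omega,
        show l + 3 - 3 = l by omega] at h6
      by_contra! h8
      nlinarith
  · left
    push Not at hclose
    obtain ⟨i, hi, j, hj, hij⟩ := hclose
    obtain ⟨x, hx, hmin⟩ := exists_min_image U (deg 𝒩) hk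
    obtain ⟨y, hy, hmax⟩ := exists_max_image U (deg 𝒩) hk
    have := hmin i hi
    have := hmax j hj
    have := card_add_two_le_of_spread hsub hne hU hind hbal hx hy hmin hmax (by omega)
    omega

end Core

/-! ### The equality case on five points -/

section FivePoints

/-- Twenty proper nonempty subsets of a five-element set force equality everywhere. -/
theorem five_points_tight {𝒯 : Finset (Finset (Fin 5))} (hne : ∅ ∉ 𝒯) (huniv : univ ∉ 𝒯)
    (hcard : #𝒯 = 20) (hbal : Balanced 𝒯) (hclose : ∀ i j, deg 𝒯 j ≤ deg 𝒯 i + 10) :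
    (∀ A : Finset (Fin 5), #A = 1 ∨ #A = 4 → A ∈ 𝒯) ∧ ∀ i j, i ≠ j → sep 𝒯 i j = 5 := by
  have hsub : ∀ A ∈ 𝒯, A ⊆ (univ : Finset (Fin 5)) := fun A _ => subset_univ A
  have hle := le_sum_sep hsub hne huniv (by simp)
  have hsum := sum_sep_le hbal (U := univ) fun i _ j _ => hclose i j
  have h1 := card_singletons_le hsub
  have h4 := card_cosingletons_le hsub
  -- The bounds now read `120 ≤ Σ + 2(s₁ + s₄)`, `Σ ≤ 100`, `s₁ ≤ 5`, `s₄ ≤ 5`: there is no slack.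
  simp only [card_univ, Fintype.card_fin, hcard] at hle hsum h1 h4
  have hmem (s : ℕ) (hs : #{A ∈ 𝒯 | #A = s} = Nat.choose 5 s) (A : Finset (Fin 5)) (hA : #A = s) :
      A ∈ 𝒯 := by
    have : ({A ∈ 𝒯 | #A = s} : Finset (Finset (Fin 5))) = powersetCard s univ := by
      refine eq_of_subset_of_card_le (fun B hB => ?_) (by simp [hs])
      exact mem_powersetCard.2 ⟨subset_univ _, (mem_filter.1 hB).2⟩
    have hA' : A ∈ powersetCard s (univ : Finset (Fin 5)) :=
      mem_powersetCard.2 ⟨subset_univ _, hA⟩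
    rw [← this] at hA'
    exact (mem_filter.1 hA').1
  have hall : ∀ A : Finset (Fin 5), #A = 1 ∨ #A = 4 → A ∈ 𝒯 := by
    rintro A (hA | hA)
    · exact hmem 1 (by rw [Nat.choose_one_right]; omega) A hA
    · refine hmem 4 ?_ A hA
      have : ({A ∈ 𝒯 | #A = 4} : Finset _) = ({A ∈ 𝒯 | #A + 1 = 5} : Finset _) := by
        ext; simp
      rw [this, show Nat.choose 5 4 = 5 from rfl]
      omega
  have hle5 : ∀ i j, i ≠ j → sep 𝒯 i j ≤ 5 := fun i j hij =>
    hbal j i (sep_ne_zero.2 ⟨{j}, hall _ (by simp), by simp, by simpa using hij⟩)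
  refine ⟨hall, fun i j hij => ?_⟩
  have heq : ∑ p ∈ (univ : Finset (Fin 5)).offDiag, sep 𝒯 p.1 p.2 =
      ∑ p ∈ (univ : Finset (Fin 5)).offDiag, 5 := by
    refine le_antisymm (sum_le_sum fun p hp => hle5 _ _ (mem_offDiag.1 hp).2.2) ?_
    simp only [sum_const, offDiag_card, card_univ, Fintype.card_fin]
    norm_num
    omega
  exact (sum_eq_sum_iff_of_le fun p hp => hle5 _ _ (mem_offDiag.1 hp).2.2).1 heq (i, j)
    (by simp [hij])

/-- The indicator of a finite set. -/
def ind {α : Type*} [DecidableEq α] (𝒯 : Finset α) (A : α) : ℕ := if A ∈ 𝒯 then 1 else 0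

/-- Of the eight sets containing `i` and missing `j`, the 1-set and the 4-set are present, so three
of the other six are. -/
theorem sep_five {𝒯 : Finset (Finset (Fin 5))} {i j a b c : Fin 5}
    (hfil : (univ.filter fun A : Finset (Fin 5) => i ∈ A ∧ j ∉ A) =
      [{i}, {i, a}, {i, b}, {i, c}, {j, a}ᶜ, {j, b}ᶜ, {j, c}ᶜ, {j}ᶜ].toFinset)
    (hnd : ([{i}, {i, a}, {i, b}, {i, c}, {j, a}ᶜ, {j, b}ᶜ, {j, c}ᶜ, {j}ᶜ] :
      List (Finset (Fin 5))).Nodup)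
    (hall : ∀ A : Finset (Fin 5), #A = 1 ∨ #A = 4 → A ∈ 𝒯) (hsep : sep 𝒯 i j = 5) :
    ind 𝒯 {i, a} + ind 𝒯 {i, b} + ind 𝒯 {i, c} +
      (ind 𝒯 {j, a}ᶜ + ind 𝒯 {j, b}ᶜ + ind 𝒯 {j, c}ᶜ) = 3 := by
  have h : sep 𝒯 i j = ∑ A ∈ univ.filter (fun A : Finset (Fin 5) => i ∈ A ∧ j ∉ A), ind 𝒯 A := by
    simp only [sep, ind]
    rw [← card_filter]
    congr 1
    ext A
    simp only [mem_filter, mem_univ, true_and]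
    tauto
  rw [hfil, List.sum_toFinset _ hnd] at h
  have h1 : ind 𝒯 {i} = 1 := if_pos (hall _ (by simp))
  have h2 : ind 𝒯 {j}ᶜ = 1 := if_pos (hall _ (by simp [card_compl]))
  simp only [List.map_cons, List.map_nil, List.sum_cons, List.sum_nil] at h
  omega

/-- Adjacency in the 5-cycle. -/
def cyc (i j : Fin 5) : Bool := decide (j = i + 1 ∨ i = j + 1)

/-- The handshake lemma leaves degrees 0, 2 and 4, and a 2-regular graph on five vertices is a
5-cycle. -/
theorem regular_five : ∀ g01 g02 g03 g04 g12 g13 g14 g23 g24 g34 : Bool,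
    g01.toNat + g02.toNat + g03.toNat + g04.toNat = g01.toNat + g12.toNat + g13.toNat + g14.toNat →
    g01.toNat + g02.toNat + g03.toNat + g04.toNat = g02.toNat + g12.toNat + g23.toNat + g24.toNat →
    g01.toNat + g02.toNat + g03.toNat + g04.toNat = g03.toNat + g13.toNat + g23.toNat + g34.toNat →
    g01.toNat + g02.toNat + g03.toNat + g04.toNat = g04.toNat + g14.toNat + g24.toNat + g34.toNat →
    (g01 && g02 && g03 && g04 && g12 && g13 && g14 && g23 && g24 && g34) = true ∨
    (g01 || g02 || g03 || g04 || g12 || g13 || g14 || g23 || g24 || g34) = false ∨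
    ∃ a b c d : Fin 5, [0, a, b, c, d].Nodup ∧
      ∀ i j : Fin 5, i < j → cyc i j = (![![false, g01, g02, g03, g04], ![g01, false, g12, g13, g14],
        ![g02, g12, false, g23, g24], ![g03, g13, g23, false, g34],
        ![g04, g14, g24, g34, false]] : Fin 5 → Fin 5 → Bool)
          ((![0, a, b, c, d] : Fin 5 → Fin 5) i) ((![0, a, b, c, d] : Fin 5 → Fin 5) j) := by
  decide

/-- The subsets of `Fin 5` of size 0, 1, 4, the edges of `adj`, and the complements of the
non-edges of `adj`. -/
def blockFamily (adj : Fin 5 → Fin 5 → Bool) : Finset (Finset (Fin 5)) :=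
  {A | #A = 0 ∨ #A = 1 ∨ #A = 4 ∨ (∃ i j, i < j ∧ adj i j = true ∧ A = {i, j}) ∨
    ∃ i j, i < j ∧ adj i j = false ∧ A = {i, j}ᶜ}

/-- The three adjacency relations giving extremal blocks. -/
def IsBlockAdj (adj : Fin 5 → Fin 5 → Bool) : Prop :=
  adj = (fun _ _ => true) ∨ adj = (fun _ _ => false) ∨ adj = cyc

theorem IsBlockAdj.mem_blockFamily {adj : Fin 5 → Fin 5 → Bool} (h : IsBlockAdj adj) :
    ∀ i j : Fin 5, i < j → ({i, j} ∈ blockFamily adj ↔ adj i j = true) ∧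
      ({i, j}ᶜ ∈ blockFamily adj ↔ adj i j = false) := by
  rcases h with rfl | rfl | rfl <;> decide

theorem filter_mem_notMem_five : ∀ i j a b c : Fin 5, [i, j, a, b, c].Nodup →
    (univ.filter fun A : Finset (Fin 5) => i ∈ A ∧ j ∉ A) =
      [{i}, {i, a}, {i, b}, {i, c}, {j, a}ᶜ, {j, b}ᶜ, {j, c}ᶜ, {j}ᶜ].toFinset ∧
    ([{i}, {i, a}, {i, b}, {i, c}, {j, a}ᶜ, {j, b}ᶜ, {j, c}ᶜ, {j}ᶜ] :
      List (Finset (Fin 5))).Nodup := by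
  decide

theorem exists_adj_of_sep {𝒯 : Finset (Finset (Fin 5))}
    (hall : ∀ A : Finset (Fin 5), #A = 1 ∨ #A = 4 → A ∈ 𝒯)
    (hsep : ∀ i j, i ≠ j → sep 𝒯 i j = 5) :
    ∃ adj, IsBlockAdj adj ∧ ∃ σ : Equiv.Perm (Fin 5), ∀ i j, i < j →
      ({σ i, σ j} ∈ 𝒯 ↔ adj i j = true) ∧ ({σ i, σ j}ᶜ ∈ 𝒯 ↔ adj i j = false) := by
  obtain ⟨G, hG⟩ : ∃ G : Fin 5 → Fin 5 → Bool, ∀ i j, G i j = decide ({i, j} ∈ 𝒯) :=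
    ⟨_, fun _ _ => rfl⟩
  obtain ⟨H, hH⟩ : ∃ H : Fin 5 → Fin 5 → Bool, ∀ i j, H i j = decide ({i, j}ᶜ ∈ 𝒯) :=
    ⟨_, fun _ _ => rfl⟩
  have hGs (i j) : G i j = G j i := by rw [hG, hG, pair_comm]
  have hHs (i j) : H i j = H j i := by rw [hH, hH, pair_comm]
  have key (i j a b c : Fin 5) (hnd : [i, j, a, b, c].Nodup) :
      (G i a).toNat + (G i b).toNat + (G i c).toNat +
        ((H j a).toNat + (H j b).toNat + (H j c).toNat) = 3 := by
    obtain ⟨h1, h2⟩ := filter_mem_notMem_five i j a b c hnd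
    have := sep_five h1 h2 hall (hsep i j (by rintro rfl; simp at hnd))
    simpa only [ind, hG, hH, Bool.toNat, Bool.cond_decide] using this
  have e01 := key 0 1 2 3 4 (by decide)
  have e02 := key 0 2 1 3 4 (by decide)
  have e03 := key 0 3 1 2 4 (by decide)
  have e04 := key 0 4 1 2 3 (by decide)
  have e10 := key 1 0 2 3 4 (by decide)
  have e12 := key 1 2 0 3 4 (by decide)
  have e13 := key 1 3 0 2 4 (by decide)
  have e14 := key 1 4 0 2 3 (by decide)
  have e20 := key 2 0 1 3 4 (by decide)
  have e21 := key 2 1 0 3 4 (by decide)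
  have e23 := key 2 3 0 1 4 (by decide)
  have e24 := key 2 4 0 1 3 (by decide)
  have e30 := key 3 0 1 2 4 (by decide)
  have e31 := key 3 1 0 2 4 (by decide)
  have e32 := key 3 2 0 1 4 (by decide)
  have e34 := key 3 4 0 1 2 (by decide)
  have e40 := key 4 0 1 2 3 (by decide)
  have e41 := key 4 1 0 2 3 (by decide)
  have e42 := key 4 2 0 1 3 (by decide)
  have e43 := key 4 3 0 1 2 (by decide)
  simp only [hGs 1 0, hGs 2 0, hGs 3 0, hGs 4 0, hGs 2 1, hGs 3 1, hGs 4 1, hGs 3 2, hGs 4 2,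
    hGs 4 3, hHs 1 0, hHs 2 0, hHs 3 0, hHs 4 0, hHs 2 1, hHs 3 1, hHs 4 1, hHs 3 2, hHs 4 2,
    hHs 4 3] at e01 e02 e03 e04 e10 e12 e13 e14 e20 e21 e23 e24 e30 e31 e32 e34 e40 e41 e42 e43
  -- Write `g`, `h` for the degrees in `G`, `H` and `s` for `G i j + H i j`; the equations are `g i
  -- + h j - s = 3`. Exchanging `i` and `j` shows that `g - h` is constant, summing over `j` that
  -- `g` is. So `s` is constant, and `4s = g + h = s + 3` gives `s = 1`.
  have hcompl : ∀ i j, i < j → (H i j).toNat + (G i j).toNat = 1 := by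
    intro i j hij
    fin_cases i <;> fin_cases j <;> first | exact absurd hij (by decide) | (simp; omega)
  have hHG : ∀ i j, i ≠ j → H i j = !(G i j) := by
    intro i j hij
    rcases lt_or_gt_of_ne hij with h | h
    · have := hcompl i j h
      cases hg : G i j <;> cases hh : H i j <;> simp [hg, hh] at this ⊢
    · have := hcompl j i h
      rw [hHs i j, hGs i j]
      cases hg : G j i <;> cases hh : H j i <;> simp [hg, hh] at this ⊢
  suffices h : ∃ adj, IsBlockAdj adj ∧ ∃ σ : Equiv.Perm (Fin 5), ∀ i j, i < j →
      adj i j = G (σ i) (σ j) by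
    obtain ⟨adj, hadj, σ, h⟩ := h
    refine ⟨adj, hadj, σ, fun i j hij => ?_⟩
    have h1 := hHG (σ i) (σ j) (σ.injective.ne hij.ne)
    rw [← h i j hij, hH] at h1
    have h2 := h i j hij
    rw [hG] at h2
    rw [h2] at h1 ⊢
    constructor
    · simp
    · rw [← decide_eq_true_iff (p := {σ i, σ j}ᶜ ∈ 𝒯), h1]
      simp
  rcases regular_five (G 0 1) (G 0 2) (G 0 3) (G 0 4) (G 1 2) (G 1 3) (G 1 4) (G 2 3) (G 2 4)
    (G 3 4) (by omega) (by omega) (by omega) (by omega) with h | h | ⟨a, b, c, d, hnd, h⟩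
  · refine ⟨_, Or.inl rfl, 1, fun i j hij => ?_⟩
    simp only [Bool.and_eq_true] at h
    fin_cases i <;> fin_cases j <;> first | exact absurd hij (by decide) | (simp [h])
  · refine ⟨_, Or.inr (Or.inl rfl), 1, fun i j hij => ?_⟩
    simp only [Bool.or_eq_false_iff] at h
    fin_cases i <;> fin_cases j <;> first | exact absurd hij (by decide) | (simp [h])
  · have hinj : Function.Injective (![0, a, b, c, d] : Fin 5 → Fin 5) :=
      List.nodup_ofFn.1 hnd
    refine ⟨_, Or.inr (Or.inr rfl), Equiv.ofBijective _ (Finite.injective_iff_bijective.1 hinj),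
      fun i j hij => ?_⟩
    rw [h i j hij]
    have hne := hinj.ne hij.ne
    simp only [Equiv.ofBijective_apply]
    generalize (![0, a, b, c, d] : Fin 5 → Fin 5) i = p at hne ⊢
    generalize (![0, a, b, c, d] : Fin 5 → Fin 5) j = q at hne ⊢
    fin_cases p <;> fin_cases q <;> first | exact absurd rfl hne | rfl | exact hGs _ _

theorem exists_blockFamily {𝒯 : Finset (Finset (Fin 5))} (hne : ∅ ∉ 𝒯) (huniv : univ ∉ 𝒯)
    (hcard : #𝒯 = 20) (hbal : Balanced 𝒯) (hclose : ∀ i j, deg 𝒯 j ≤ deg 𝒯 i + 10) :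
    ∃ adj, IsBlockAdj adj ∧ ∃ σ : Equiv.Perm (Fin 5), ∀ A : Finset (Fin 5),
      A.map σ.toEmbedding ∈ insert ∅ 𝒯 ↔ A ∈ blockFamily adj := by
  obtain ⟨hall, hsep⟩ := five_points_tight hne huniv hcard hbal hclose
  obtain ⟨adj, hadj, σ, h⟩ := exists_adj_of_sep hall hsep
  refine ⟨adj, hadj, σ, fun A => ?_⟩
  have hpair : ∀ B : Finset (Fin 5), #B = 2 → ∃ i j, i < j ∧ B = {i, j} := by
    intro B hB
    obtain ⟨i, j, hij, rfl⟩ := card_eq_two.1 hB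
    rcases lt_or_gt_of_ne hij with hlt | hlt
    · exact ⟨i, j, hlt, rfl⟩
    · exact ⟨j, i, hlt, pair_comm _ _⟩
  have hle : #A ≤ 5 := by simpa using card_le_univ A
  have hmem (hA : #A = 1 ∨ #A = 4) :
      A.map σ.toEmbedding ∈ insert ∅ 𝒯 ↔ A ∈ blockFamily adj := by
    refine iff_of_true (mem_insert_of_mem (hall _ (by simpa using hA))) ?_
    simp only [blockFamily, mem_filter, mem_univ, true_and]
    tauto
  interval_cases hA : #A
  · rw [card_eq_zero] at hA
    simp [hA, blockFamily]
  · exact hmem (Or.inl rfl)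
  · obtain ⟨i, j, hij, rfl⟩ := hpair A hA
    rw [(hadj.mem_blockFamily i j hij).1, ← (h i j hij).1, mem_insert]
    simp
  · obtain ⟨i, j, hij, hB⟩ := hpair Aᶜ (by rw [card_compl, hA]; rfl)
    obtain rfl : A = {i, j}ᶜ := by rw [← hB, compl_compl]
    have hmap : ({i, j}ᶜ : Finset (Fin 5)).map σ.toEmbedding = {σ i, σ j}ᶜ := by
      ext x
      simp only [mem_map_equiv, mem_compl, mem_insert, mem_singleton, Equiv.symm_apply_eq]
    rw [(hadj.mem_blockFamily i j hij).2, ← (h i j hij).2, hmap, mem_insert, or_iff_right]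
    intro h0
    rw [← hmap, map_eq_empty] at h0
    simp [h0] at hA
  · exact hmem (Or.inr rfl)
  · obtain rfl : A = univ := by rw [← card_eq_iff_eq_univ]; simpa using hA
    refine iff_of_false ?_ ?_
    · rw [univ_map_equiv_to_embedding, mem_insert]
      simp [huniv, univ_eq_empty_iff]
    · rcases hadj with rfl | rfl | rfl <;> decide

end FivePoints

/-! ### Decomposition along dominating sets -/

section Towers

variable {R : Type*} [DecidableEq R]

theorem sep_mono {𝒜 ℬ : Finset (Finset R)} (h : 𝒜 ⊆ ℬ) (i j : R) : sep 𝒜 i j ≤ sep ℬ i j :=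
  card_le_card (filter_subset_filter _ h)

theorem Balanced.mono {𝒜 ℬ : Finset (Finset R)} (hℬ : Balanced ℬ) (h : 𝒜 ⊆ ℬ) : Balanced 𝒜 := by
  intro i j hij
  have h1 := sep_mono h i j
  exact (sep_mono h j i).trans (hℬ i j (by omega))

theorem sep_erase_empty (𝒜 : Finset (Finset R)) (i j : R) : sep (𝒜.erase ∅) i j = sep 𝒜 i j := by
  rw [sep, sep]
  congr 1
  ext A
  simp only [mem_filter, mem_erase]
  constructor
  · tauto
  · rintro ⟨h1, h2, h3⟩
    exact ⟨⟨ne_empty_of_mem h2, h1⟩, h2, h3⟩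

/-- The image of a set family under an embedding of the ground sets. -/
def push {α β : Type*} (e : α ↪ β) (𝒯 : Finset (Finset α)) : Finset (Finset β) :=
  𝒯.map (mapEmbedding e).toEmbedding

theorem mem_push {α β : Type*} {e : α ↪ β} {𝒯 : Finset (Finset α)} {B : Finset β} :
    B ∈ push e 𝒯 ↔ ∃ A ∈ 𝒯, A.map e = B := by
  simp [push, mem_map]

theorem map_mem_push {α β : Type*} {e : α ↪ β} {𝒯 : Finset (Finset α)} {A : Finset α} :
    A.map e ∈ push e 𝒯 ↔ A ∈ 𝒯 := by
  rw [mem_push]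
  simp

theorem card_push {α β : Type*} (e : α ↪ β) (𝒯 : Finset (Finset α)) : #(push e 𝒯) = #𝒯 :=
  card_map _

theorem sep_push {α : Type*} [DecidableEq α] (e : α ↪ R) (𝒯 : Finset (Finset α)) (i j : α) :
    sep (push e 𝒯) (e i) (e j) = sep 𝒯 i j := by
  simp [sep, push, filter_map]

theorem deg_push {α : Type*} [DecidableEq α] (e : α ↪ R) (𝒯 : Finset (Finset α)) (i : α) :
    deg (push e 𝒯) (e i) = deg 𝒯 i := by
  simp [deg, push, filter_map, Function.comp_def]

theorem exists_eq_push {α : Type*} [Fintype α] (e : α ↪ R) {ℬ : Finset (Finset R)}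
    (h : ∀ B ∈ ℬ, B ⊆ univ.map e) : ∃ 𝒯, ℬ = push e 𝒯 := by
  classical
  refine ⟨univ.filter fun A => A.map e ∈ ℬ, ?_⟩
  ext B
  rw [mem_push]
  constructor
  · intro hB
    obtain ⟨A, -, rfl⟩ := subset_map_iff.1 (h B hB)
    exact ⟨A, by simpa using hB, rfl⟩
  · rintro ⟨A, hA, rfl⟩
    simpa using hA

theorem push_subset {R α : Type*} [Fintype α] {e : α ↪ R} {𝒯 : Finset (Finset α)} :
    ∀ B ∈ push e 𝒯, B ⊆ univ.map e := by
  intro B hB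
  obtain ⟨A, -, rfl⟩ := mem_push.1 hB
  exact map_subset_map.2 (subset_univ A)

theorem exists_map_univ_eq {R : Type*} {k : ℕ} {U : Finset R} (h : #U = k) :
    ∃ e : Fin k ↪ R, univ.map e = U := by
  refine ⟨(U.equivFinOfCardEq h).symm.toEmbedding.trans (Function.Embedding.subtype _), ?_⟩
  rw [← map_map, univ_map_equiv_to_embedding]
  exact attach_map_val

theorem IsBlockAdj.card_blockFamily {adj : Fin 5 → Fin 5 → Bool} (h : IsBlockAdj adj) :
    #(blockFamily adj) = 21 := by
  rcases h with rfl | rfl | rfl <;> decide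

theorem IsBlockAdj.univ_notMem_blockFamily {adj : Fin 5 → Fin 5 → Bool} (h : IsBlockAdj adj) :
    univ ∉ blockFamily adj := by
  rcases h with rfl | rfl | rfl <;> decide

theorem IsBlockAdj.sep_blockFamily {adj : Fin 5 → Fin 5 → Bool} (h : IsBlockAdj adj) :
    ∀ i j, sep (blockFamily adj) i j ≤ 5 := by
  rcases h with rfl | rfl | rfl <;> decide

theorem Indecomposable.block {U : Finset R} {ℬ : Finset (Finset R)}
    (hsub : ∀ A ∈ ℬ, A ⊆ U) (hU : U ∉ ℬ) (hk : U.Nonempty)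
    (hind : Indecomposable U ℬ) (hbal : Balanced ℬ) :
    5 * #ℬ + 5 ≤ 21 * #U ∨ ∃ (e : Fin 5 ↪ R) (adj : Fin 5 → Fin 5 → Bool),
      IsBlockAdj adj ∧ univ.map e = U ∧ ℬ = push e (blockFamily adj) := by
  -- The empty set separates nothing, so it can be dropped to apply `card_bound` and costs one in
  -- the count.
  have hind' : Indecomposable U (ℬ.erase ∅) := by
    intro V h1 h2 h3
    simpa only [sep_erase_empty] using hind V h1 h2 h3
  have hcard := card_erase_add_one (s := ℬ) (a := ∅)
  have hcard' : ∅ ∉ ℬ → #(ℬ.erase ∅) = #ℬ := fun h => by rw [erase_eq_of_notMem h]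
  have hbal' : Balanced (ℬ.erase ∅) := hbal.mono (erase_subset _ _)
  have hsub' : ∀ A ∈ ℬ.erase ∅, A ⊆ U := fun A hA => hsub A (mem_of_mem_erase hA)
  rcases hind'.card_bound hsub' (notMem_erase _ _) (fun h => hU (mem_of_mem_erase h)) hk hbal' with
    h | ⟨h5, h20, hclose⟩
  · left
    by_cases h0 : ∅ ∈ ℬ
    · have := hcard h0; omega
    · have := hcard' h0; omega
  by_cases h21 : #ℬ ≤ 20
  · left; omega
  right
  have h0 : ∅ ∈ ℬ := by
    by_contra h0
    have := hcard' h0; omega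
  have := hcard h0
  obtain ⟨e, he⟩ := exists_map_univ_eq h5
  subst he
  obtain ⟨𝒯, h𝒯⟩ := exists_eq_push e hsub'
  rw [h𝒯] at hbal' hclose
  obtain ⟨adj, hadj, σ, hσ⟩ := exists_blockFamily (𝒯 := 𝒯)
    (fun h => notMem_erase ∅ ℬ (h𝒯 ▸ mem_push.2 ⟨∅, h, map_empty _⟩))
    (fun h => hU (mem_of_mem_erase (h𝒯 ▸ mem_push.2 ⟨univ, h, rfl⟩)))
    (by rw [← card_push e, ← h𝒯]; omega)
    (fun i j h => by rw [← sep_push e] at h ⊢; exact hbal' _ _ h)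
    (fun i j => by
      have := hclose (e i) (by simp) (e j) (by simp)
      rwa [deg_push, deg_push] at this)
  refine ⟨σ.toEmbedding.trans e, adj, hadj, ?_, ?_⟩
  · rw [← map_map, univ_map_equiv_to_embedding]
  · ext B
    rw [mem_push]
    have hB : B ∈ ℬ ↔ B ∈ push e (insert ∅ 𝒯) := by
      rw [← insert_erase h0, h𝒯]
      simp [push]
    rw [hB, mem_push]
    constructor
    · rintro ⟨A, hA, rfl⟩
      refine ⟨A.map σ.symm.toEmbedding, ?_, ?_⟩
      · rw [← hσ, map_map]
        simpa using hA
      · rw [map_map]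
        congr 1
        ext x
        simp
    · rintro ⟨A, hA, rfl⟩
      exact ⟨A.map σ.toEmbedding, (hσ A).2 hA, map_map _ _ _⟩

/-- The set families of the extremal matrices, together with their ground sets: five-point
blocks put successively on top of each other. -/
inductive Tower : Finset R → Finset (Finset R) → Prop
  | nil : Tower ∅ {∅}
  | cons {L : Finset R} {𝒜 : Finset (Finset R)} (e : Fin 5 ↪ R) (adj : Fin 5 → Fin 5 → Bool)
      (hadj : IsBlockAdj adj) (hdisj : Disjoint (univ.map e) L) (h : Tower L 𝒜) :
      Tower (univ.map e ∪ L) (push e (blockFamily adj) ∪ 𝒜.image (univ.map e ∪ ·))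

/-- The family `𝒜` put below the family `ℬ` of subsets of `U`. -/
def stack (U : Finset R) (ℬ 𝒜 : Finset (Finset R)) : Finset (Finset R) := ℬ ∪ 𝒜.image (U ∪ ·)

theorem card_stack {U L : Finset R} {ℬ 𝒜 : Finset (Finset R)} (hUL : Disjoint U L)
    (hℬ : ∀ B ∈ ℬ, B ⊆ U) (hU : U ∉ ℬ) (h𝒜 : ∀ A ∈ 𝒜, A ⊆ L) : #(stack U ℬ 𝒜) = #ℬ + #𝒜 := by
  rw [stack, card_union_of_disjoint, card_image_of_injOn]
  · intro A hA B hB hAB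
    have h1 := congrArg (· \ U) hAB
    have h2 (A) (hA : A ∈ 𝒜) : (U ∪ A) \ U = A := by
      rw [union_sdiff_left]
      exact sdiff_eq_self_of_disjoint (hUL.symm.mono_left (h𝒜 A hA))
    simpa only [h2 A hA, h2 B hB] using h1
  · rw [disjoint_left]
    intro B hB hB'
    obtain ⟨A, -, rfl⟩ := mem_image.1 hB'
    exact hU (subset_antisymm (hℬ _ hB) subset_union_left ▸ hB)

theorem stack_subset {U L : Finset R} {ℬ 𝒜 : Finset (Finset R)}
    (hℬ : ∀ B ∈ ℬ, B ⊆ U) (h𝒜 : ∀ A ∈ 𝒜, A ⊆ L) : ∀ A ∈ stack U ℬ 𝒜, A ⊆ U ∪ L := by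
  intro A hA
  rcases mem_union.1 hA with h | h
  · exact (hℬ A h).trans subset_union_left
  · obtain ⟨B, hB, rfl⟩ := mem_image.1 h
    exact union_subset_union_right (h𝒜 B hB)

theorem Tower.subset {S : Finset R} {𝒜 : Finset (Finset R)} (h : Tower S 𝒜) :
    ∀ A ∈ 𝒜, A ⊆ S := by
  induction h with
  | nil => simp
  | cons e adj hadj hdisj h ih => exact stack_subset push_subset ih

theorem IsBlockAdj.map_univ_notMem {R : Type*} {adj : Fin 5 → Fin 5 → Bool} (h : IsBlockAdj adj)
    (e : Fin 5 ↪ R) : univ.map e ∉ push e (blockFamily adj) := by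
  rw [map_mem_push]
  exact h.univ_notMem_blockFamily

theorem Tower.card {S : Finset R} {𝒜 : Finset (Finset R)} (h : Tower S 𝒜) :
    5 * #𝒜 = 21 * #S + 5 := by
  induction h with
  | nil => simp
  | cons e adj hadj hdisj h ih =>
    have := card_stack hdisj push_subset (hadj.map_univ_notMem e) h.subset
    rw [stack, card_push, hadj.card_blockFamily] at this
    rw [this, card_union_of_disjoint hdisj, card_map, card_univ, Fintype.card_fin]
    omega

/-- Cut off a minimal dominating `U`. A piece that is not a block saves the 5 that the rest may
exceed its bound by; a block meets `21 * #U` exactly and passes the excess on. -/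
theorem card_le_or_tower (S : Finset R) (𝒜 : Finset (Finset R)) (hsub : ∀ A ∈ 𝒜, A ⊆ S)
    (hbal : Balanced 𝒜) : 5 * #𝒜 ≤ 21 * #S ∨ Tower S 𝒜 := by
  induction S using Finset.strongInduction generalizing 𝒜 with
  | H S ih =>
  rcases S.eq_empty_or_nonempty with rfl | hS
  · have h1 : 𝒜 ⊆ {∅} := fun A hA => mem_singleton.2 (subset_empty.1 (hsub A hA))
    rcases subset_singleton_iff.1 h1 with rfl | rfl
    · left; simp
    · exact Or.inr Tower.nil
  -- a minimal dominating part of the ground set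
  obtain ⟨U, hU, hmin⟩ := exists_min_image
    (S.powerset.filter fun U => U.Nonempty ∧ ∀ i ∈ S \ U, ∀ j ∈ U, sep 𝒜 i j = 0) card
    ⟨S, by simp +contextual [hS]⟩
  simp only [mem_filter, mem_powerset] at hU hmin
  obtain ⟨hUS, hUne, hdom⟩ := hU
  have hdom' : ∀ i ∈ S \ U, ∀ j ∈ U, ∀ A ∈ 𝒜, i ∈ A → j ∈ A := by
    intro i hi j hj A hA hiA
    by_contra hjA
    exact sep_ne_zero.2 ⟨A, hA, hiA, hjA⟩ (hdom i hi j hj)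
  set ℬ := 𝒜.filter fun A => ¬ U ⊆ A with hℬ
  set 𝒞 := (𝒜.filter fun A => U ⊆ A).image (· \ U) with h𝒞
  have hℬsub : ∀ A ∈ ℬ, A ⊆ U := by
    intro A hA i hi
    rw [hℬ, mem_filter, not_subset] at hA
    obtain ⟨hA, j, hj, hjA⟩ := hA
    by_contra hiU
    exact hjA (hdom' i (mem_sdiff.2 ⟨hsub A hA hi, hiU⟩) j hj A hA hi)
  have hUℬ : U ∉ ℬ := by simp [hℬ]
  have h𝒞sub : ∀ A ∈ 𝒞, A ⊆ S \ U := by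
    intro A hA
    obtain ⟨B, hB, rfl⟩ := mem_image.1 hA
    exact sdiff_subset_sdiff (hsub B (mem_filter.1 hB).1) le_rfl
  have hdisj : Disjoint U (S \ U) := disjoint_sdiff
  have hstack : 𝒜 = stack U ℬ 𝒞 := by
    ext A
    rw [stack, mem_union, h𝒞, image_image, mem_image, hℬ, mem_filter]
    constructor
    · intro hA
      by_cases hUA : U ⊆ A
      · exact Or.inr ⟨A, mem_filter.2 ⟨hA, hUA⟩, union_sdiff_of_subset hUA⟩
      · exact Or.inl ⟨hA, hUA⟩
    · rintro (⟨hA, -⟩ | ⟨B, hB, rfl⟩)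
      · exact hA
      · rw [mem_filter] at hB
        simpa only [Function.comp_apply, union_sdiff_of_subset hB.2] using hB.1
  have hcard : #𝒜 = #ℬ + #𝒞 := by
    conv_lhs => rw [hstack]
    exact card_stack hdisj hℬsub hUℬ h𝒞sub
  have hcardS : #S = #U + #(S \ U) := by
    rw [← card_union_of_disjoint hdisj, union_sdiff_of_subset hUS]
  have hind : Indecomposable U ℬ := by
    intro V hVU hV hVne
    by_contra! hcon
    have hlt := card_lt_card (hVU.ssubset_of_ne hVne)
    -- A `V` violating indecomposability would dominate in all of `𝒜`: a set missing a point of `V ⊆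
    -- U` belongs to `ℬ` and so lies inside `U`.
    refine absurd (hmin V ⟨hVU.trans hUS, hV, fun i hi j hj => ?_⟩) (by omega)
    by_contra hne
    obtain ⟨A, hA, hiA, hjA⟩ := sep_ne_zero.1 hne
    rw [mem_sdiff] at hi
    have hAℬ : A ∈ ℬ := mem_filter.2 ⟨hA, fun h => hjA (h (hVU hj))⟩
    exact sep_ne_zero.2 ⟨A, hAℬ, hiA, hjA⟩ (hcon i (mem_sdiff.2 ⟨hℬsub A hAℬ hiA, hi.2⟩) j hj)
  have hbal𝒞 : Balanced 𝒞 := by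
    have hzero : ∀ i ∈ U, ∀ j, sep 𝒞 i j = 0 := by
      intro i hi j
      by_contra h
      obtain ⟨A, hA, hiA, -⟩ := sep_ne_zero.1 h
      exact (mem_sdiff.1 (h𝒞sub A hA hiA)).2 hi
    have hle : ∀ i, ∀ j ∉ U, sep 𝒞 i j ≤ sep 𝒜 i j := by
      intro i j hj
      rw [sep, sep, h𝒞, filter_image]
      refine card_image_le.trans (card_le_card fun A hA => ?_)
      simp only [mem_filter, mem_sdiff] at hA ⊢
      tauto
    intro i j hij
    by_cases hj : j ∈ U
    · rw [hzero j hj]; omega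
    by_cases hi : i ∈ U
    · exact absurd (hzero i hi j) hij
    have h1 := hle i j hj
    exact (hle j i hi).trans (hbal i j (by omega))
  have hL := ih (S \ U) (sdiff_ssubset hUS hUne) 𝒞 h𝒞sub hbal𝒞
  have hL' : 5 * #𝒞 ≤ 21 * #(S \ U) + 5 := hL.elim (by omega) fun h => h.card.le
  rcases hind.block hℬsub hUℬ hUne (hbal.mono (filter_subset _ _)) with h | ⟨e, adj, hadj, he, hpush⟩
  · left; omega
  rcases hL with hL | hL
  · left
    have h1 : #ℬ = 21 := by rw [hpush, card_push, hadj.card_blockFamily]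
    have h2 : #U = 5 := by rw [← he, card_map, card_univ, Fintype.card_fin]
    omega
  · right
    have := Tower.cons e adj hadj (he ▸ hdisj) hL
    rw [he, ← hpush, union_sdiff_of_subset hUS] at this
    rw [hstack]
    exact this

end Towers

theorem fin_two_ne_one {a : Fin 2} : a ≠ 1 ↔ a = 0 := by omega

theorem fin_two_ext {a b : Fin 2} (h : a = 1 ↔ b = 1) : a = b := by omega

/-! ### Matrices as families of column supports -/

section Columns

variable {R R' C C' : Type*}

/-- The finset `A` is the support of a column of `M`. -/
def IsCol (M : Matrix R C (Fin 2)) (A : Finset R) : Prop := ∃ c, ∀ x, x ∈ A ↔ M x c = 1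

theorem PermEquiv.isSimple {A : Matrix R C (Fin 2)} {B : Matrix R' C' (Fin 2)}
    (h : PermEquiv A B) (hB : IsSimple B) : IsSimple A := by
  obtain ⟨r, c, rfl⟩ := h
  refine fun j j' hj => c.injective (hB _ _ fun i => ?_)
  simpa using hj (r.symm i)

theorem PermEquiv.isConfig {R₀ C₀ : Type*} {F : Matrix R₀ C₀ (Fin 2)} {A : Matrix R C (Fin 2)}
    {B : Matrix R' C' (Fin 2)} (h : PermEquiv A B) (hA : IsConfig F A) : IsConfig F B := by
  obtain ⟨r, c, rfl⟩ := h
  obtain ⟨r', c', rfl⟩ := hA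
  exact ⟨r'.trans r.toEmbedding, c'.trans c.toEmbedding, rfl⟩

theorem PermEquiv.isCol_map {A : Matrix R C (Fin 2)} {B : Matrix R' C' (Fin 2)}
    (h : PermEquiv A B) : ∃ r : R ≃ R', ∀ S, IsCol B (S.map r.toEmbedding) ↔ IsCol A S := by
  obtain ⟨r, c, rfl⟩ := h
  refine ⟨r, fun S => ?_⟩
  simp only [IsCol, Matrix.submatrix_apply, mem_map_equiv]
  constructor
  · rintro ⟨j, hj⟩
    exact ⟨c.symm j, fun x => by simpa using hj (r x)⟩
  · rintro ⟨j, hj⟩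
    exact ⟨c j, fun x => by simpa using hj (r.symm x)⟩

theorem permEquiv_of_isCol [Fintype R] {A : Matrix R C (Fin 2)} {B : Matrix R' C' (Fin 2)}
    (hA : IsSimple A) (hB : IsSimple B) (r : R ≃ R')
    (h : ∀ S : Finset R, IsCol A S ↔ IsCol B (S.map r.toEmbedding)) : PermEquiv A B := by
  classical
  have h1 : ∀ j, ∃ j', ∀ x, A x j = B (r x) j' := by
    intro j
    obtain ⟨j', hj'⟩ := (h (univ.filter fun x => A x j = 1)).1 ⟨j, by simp⟩
    refine ⟨j', fun x => fin_two_ext ?_⟩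
    rw [← hj' (r x)]
    simp
  have h2 : ∀ j', ∃ j, ∀ x, A x j = B (r x) j' := by
    intro j'
    obtain ⟨j, hj⟩ := (h (univ.filter fun x => B (r x) j' = 1)).2
      ⟨j', fun x => by simp [mem_map_equiv]⟩
    refine ⟨j, fun x => fin_two_ext ?_⟩
    rw [← hj x]
    simp
  choose f hf using h1
  refine ⟨r, Equiv.ofBijective f ⟨fun j k hjk => hA j k fun x => ?_, fun j' => ?_⟩,
    Matrix.ext fun x j => hf j x⟩
  · rw [hf, hf, hjk]
  · obtain ⟨j, hj⟩ := h2 j'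
    refine ⟨j, hB _ _ fun i => ?_⟩
    obtain ⟨x, rfl⟩ := r.surjective i
    rw [← hf, hj]

variable [Fintype R] [DecidableEq R] [Fintype C]

/-- The family of the supports of the columns of a matrix. -/
def fam (M : Matrix R C (Fin 2)) : Finset (Finset R) :=
  univ.image fun c => univ.filter fun x => M x c = 1

theorem mem_fam {M : Matrix R C (Fin 2)} {A : Finset R} : A ∈ fam M ↔ IsCol M A := by
  simp [fam, IsCol, Finset.ext_iff, eq_comm]

theorem IsSimple.injective {R C : Type*} [Fintype R] {M : Matrix R C (Fin 2)} (hM : IsSimple M) :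
    Function.Injective fun c => univ.filter fun x => M x c = 1 := by
  intro c c' h
  refine hM c c' fun x => fin_two_ext ?_
  simpa using Finset.ext_iff.1 h x

theorem IsSimple.card_fam {M : Matrix R C (Fin 2)} (hM : IsSimple M) : #(fam M) = Fintype.card C := by
  rw [fam, card_image_of_injective _ hM.injective, card_univ]

theorem IsSimple.sep_fam {M : Matrix R C (Fin 2)} (hM : IsSimple M) (i j : R) :
    sep (fam M) i j = #{c | M i c = 1 ∧ M j c = 0} := by
  rw [sep, fam, filter_image, card_image_of_injective _ hM.injective]
  simp [fin_two_ne_one]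

/-- The single column `(0,1)ᵀ` witnesses a nonzero `sep`, and the six columns `(1,0)ᵀ` an opposite
`sep` of at least 6. -/
theorem IsSimple.isConfig_iff {M : Matrix R C (Fin 2)} (hM : IsSimple M) :
    IsConfig (F0p10 6) M ↔ ¬ Balanced (fam M) := by
  simp only [Balanced, not_forall, hM.sep_fam]
  constructor
  · rintro ⟨r, c, h⟩
    have h' (i j) : M (r i) (c j) = F0p10 6 i j := by rw [← h]; rfl
    refine ⟨r 1, r 0, ?_, ?_⟩
    · refine (card_pos.2 ⟨c 6, ?_⟩).ne'
      simp [h', F0p10]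
    · rw [not_le]
      have : #(univ.map (Fin.castSuccEmb.trans c : Fin 6 ↪ C)) = 6 := by simp
      refine lt_of_lt_of_le (by omega) (this.ge.trans (card_le_card fun x hx => ?_))
      obtain ⟨j, -, rfl⟩ := mem_map.1 hx
      simp [h', F0p10]
  · rintro ⟨i, j, h1, h2⟩
    obtain ⟨c₀, hc₀⟩ := card_pos.1 (Nat.pos_of_ne_zero h1)
    rw [not_le, ← Nat.succ_le_iff] at h2
    obtain ⟨f⟩ : Nonempty (Fin 6 ↪ {c // M j c = 1 ∧ M i c = 0}) :=
      Function.Embedding.nonempty_of_card_le (by simpa [Fintype.card_subtype] using h2)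
    have hf (k) := (f k).2
    replace hc₀ := (mem_filter.1 hc₀).2
    have hij : j ≠ i := by rintro rfl; simp [hc₀.1] at hc₀
    refine ⟨⟨![j, i], ?_⟩, ⟨Fin.snoc (fun k => (f k).1) c₀, ?_⟩, ?_⟩
    · intro a b hab
      fin_cases a <;> fin_cases b <;> simp_all
    · refine Fin.snoc_injective_iff.2 ⟨Subtype.val_injective.comp f.injective, ?_⟩
      rintro ⟨k, hk⟩
      have := (hf k).1
      simp_all
    · refine Matrix.ext fun a b => ?_
      change M (![j, i] a) (Fin.snoc (α := fun _ => C) (fun k => (f k).1) c₀ b) = F0p10 6 a b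
      refine Fin.lastCases ?_ (fun b => ?_) b
      · rw [Fin.snoc_last]
        fin_cases a <;> simp [F0p10, hc₀]
      · rw [Fin.snoc_castSucc]
        fin_cases a <;> simp [F0p10, hf]

end Columns

/-! ### The three five-row blocks -/

section Blocks

theorem isCol_fromCols {R C C' : Type*} {M : Matrix R C (Fin 2)} {M' : Matrix R C' (Fin 2)}
    {A : Finset R} : IsCol (Matrix.fromCols M M') A ↔ IsCol M A ∨ IsCol M' A := by
  simp [IsCol, Sum.exists]

theorem isCol_K {k s : ℕ} {A : Finset (Fin k)} : IsCol (K k s) A ↔ #A = s := by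
  simp only [IsCol, K, Matrix.of_apply, Subtype.exists]
  constructor
  · rintro ⟨S, rfl, h⟩
    congr 1
    ext x
    simp [h]
  · rintro rfl
    exact ⟨A, rfl, by simp⟩

theorem isCol_cyclePair {A : Finset (Fin 5)} : IsCol cyclePair A ↔
    (∃ i j, i < j ∧ cyc i j = true ∧ A = {i, j}) ∨
      ∃ i j, i < j ∧ cyc i j = false ∧ A = {i, j}ᶜ := by
  have h1 : ∀ A : Finset (Fin 5), IsCol (incidence (SimpleGraph.cycleGraph 5)) A ↔
      ∃ e ∈ (SimpleGraph.cycleGraph 5).edgeSet, ∀ v, v ∈ A ↔ v ∈ e := by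
    intro A
    simp [IsCol, incidence]
  have h2 : ∀ A : Finset (Fin 5),
      IsCol (complement01 (incidence (SimpleGraph.cycleGraph 5)ᶜ)) A ↔
      ∃ e ∈ (SimpleGraph.cycleGraph 5)ᶜ.edgeSet, ∀ v, v ∈ A ↔ ¬ v ∈ e := by
    intro A
    simp [IsCol, incidence, complement01]
  rw [cyclePair, isCol_fromCols, h1, h2]
  revert A
  decide

theorem isCol_block_K_two {A : Finset (Fin 5)} :
    IsCol (block (K 5 2)) A ↔ A ∈ blockFamily fun _ _ => true := by
  simp only [block, isCol_fromCols, isCol_K]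
  revert A
  decide

theorem isCol_block_K_three {A : Finset (Fin 5)} :
    IsCol (block (K 5 3)) A ↔ A ∈ blockFamily fun _ _ => false := by
  simp only [block, isCol_fromCols, isCol_K]
  revert A
  decide

theorem isCol_block_cyclePair {A : Finset (Fin 5)} :
    IsCol (block cyclePair) A ↔ A ∈ blockFamily cyc := by
  simp only [block, isCol_fromCols, isCol_K, isCol_cyclePair, blockFamily, mem_filter, mem_univ,
    true_and]
  generalize (∃ i j, i < j ∧ cyc i j = true ∧ A = {i, j}) = p
  generalize (∃ i j, i < j ∧ cyc i j = false ∧ A = {i, j}ᶜ) = q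
  tauto

/-- The matrix agrees with one of the three blocks up to row and column permutations. -/
def IsBlock {R C : Type*} (B : Matrix R C (Fin 2)) : Prop :=
  PermEquiv B (block (K 5 2)) ∨ PermEquiv B (block (K 5 3)) ∨ PermEquiv B (block cyclePair)

theorem card_block_cols {C : Type*} [Fintype C] (h : Fintype.card C = 10) :
    Fintype.card ({S : Finset (Fin 5) // #S = 4} ⊕ C ⊕ {S : Finset (Fin 5) // #S = 1} ⊕
      {S : Finset (Fin 5) // #S = 0}) = 21 := by
  have h4 : Fintype.card {S : Finset (Fin 5) // #S = 4} = 5 := by simp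
  have h1 : Fintype.card {S : Finset (Fin 5) // #S = 1} = 5 := by simp
  have h0 : Fintype.card {S : Finset (Fin 5) // #S = 0} = 1 := by simp
  rw [Fintype.card_sum, Fintype.card_sum, Fintype.card_sum, h, h4, h1, h0]

theorem card_K_five {s : ℕ} (hs : s = 2 ∨ s = 3) :
    Fintype.card {S : Finset (Fin 5) // #S = s} = 10 := by
  rcases hs with rfl | rfl <;> simp [Nat.choose]

theorem card_cyclePair_cols : Fintype.card
    ((SimpleGraph.cycleGraph 5).edgeSet ⊕ ((SimpleGraph.cycleGraph 5)ᶜ).edgeSet) = 10 := by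
  rw [Fintype.card_sum]
  decide

theorem IsSimple.of_card {R C : Type*} [Fintype R] [DecidableEq R] [Fintype C]
    {M : Matrix R C (Fin 2)} {𝒯 : Finset (Finset R)} (h : ∀ A, IsCol M A ↔ A ∈ 𝒯)
    (hcard : Fintype.card C = #𝒯) : IsSimple M := by
  have h1 : fam M = 𝒯 := by ext A; rw [mem_fam, h]
  -- There are as many distinct supports as columns, so no column repeats.
  have h2 : Set.InjOn (fun c => univ.filter fun x => M x c = 1) (univ : Finset C) := by
    rw [← card_image_iff, card_univ, hcard, ← h1]
    rfl
  intro c c' hc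
  exact h2 (by simp) (by simp) (by simp [hc])

theorem permEquiv_reindex {R C C' : Type*} (M : Matrix R C (Fin 2)) (e : C' ≃ C) :
    PermEquiv (M.submatrix id e) M := ⟨Equiv.refl R, e, rfl⟩

theorem exists_reindex {C : Type*} [Fintype C] {M : Matrix (Fin 5) C (Fin 2)}
    (h : Fintype.card C = 21) :
    ∃ B : Matrix (Fin 5) (Fin 21) (Fin 2), PermEquiv B M ∧ ∀ A, IsCol B A ↔ IsCol M A := by
  let e : Fin 21 ≃ C := (Fintype.equivFinOfCardEq h).symm
  refine ⟨M.submatrix id e, permEquiv_reindex M e, fun A => ?_⟩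
  simp only [IsCol, Matrix.submatrix_apply, id]
  exact e.exists_congr_left.trans (by simp)

theorem IsBlockAdj.exists_matrix {adj : Fin 5 → Fin 5 → Bool} (h : IsBlockAdj adj) :
    ∃ B : Matrix (Fin 5) (Fin 21) (Fin 2), IsBlock B ∧ ∀ A, IsCol B A ↔ A ∈ blockFamily adj := by
  rcases h with rfl | rfl | rfl
  · obtain ⟨B, hB, h⟩ := exists_reindex (M := block (K 5 2)) (card_block_cols (card_K_five (by simp)))
    exact ⟨B, Or.inl hB, fun A => (h A).trans isCol_block_K_two⟩
  · obtain ⟨B, hB, h⟩ := exists_reindex (M := block (K 5 3)) (card_block_cols (card_K_five (by simp)))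
    exact ⟨B, Or.inr (Or.inl hB), fun A => (h A).trans isCol_block_K_three⟩
  · obtain ⟨B, hB, h⟩ := exists_reindex (M := block cyclePair) (card_block_cols card_cyclePair_cols)
    exact ⟨B, Or.inr (Or.inr hB), fun A => (h A).trans isCol_block_cyclePair⟩

/-- A block is simple, avoids the configuration, and has no column of ones. -/
theorem IsBlock.avoids {C : Type*} {B : Matrix (Fin 5) C (Fin 2)} (hB : IsBlock B) :
    IsSimple B ∧ ¬ IsConfig (F0p10 6) B ∧ ¬ IsCol B univ := by
  have key {C' : Type} [Fintype C'] {M : Matrix (Fin 5) C' (Fin 2)}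
      {adj : Fin 5 → Fin 5 → Bool} (hadj : IsBlockAdj adj) (hcard : Fintype.card C' = 21)
      (hM : ∀ A, IsCol M A ↔ A ∈ blockFamily adj) (h : PermEquiv B M) :
      IsSimple B ∧ ¬ IsConfig (F0p10 6) B ∧ ¬ IsCol B univ := by
    have hs : IsSimple M := .of_card hM (hcard.trans hadj.card_blockFamily.symm)
    refine ⟨h.isSimple hs, fun hc => ?_, fun hc => ?_⟩
    · refine hs.isConfig_iff.1 (h.isConfig hc) fun i j _ => ?_
      have h1 : fam M = blockFamily adj := by ext A; rw [mem_fam, hM]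
      rw [h1]
      exact hadj.sep_blockFamily j i
    · obtain ⟨r, hr⟩ := h.isCol_map
      rw [← hr, univ_map_equiv_to_embedding, hM] at hc
      exact hadj.univ_notMem_blockFamily hc
  rcases hB with h | h | h
  · exact key (Or.inl rfl) (card_block_cols (card_K_five (by simp))) (fun _ => isCol_block_K_two) h
  · exact key (Or.inr (Or.inl rfl)) (card_block_cols (card_K_five (by simp)))
      (fun _ => isCol_block_K_three) h
  · exact key (Or.inr (Or.inr rfl)) (card_block_cols card_cyclePair_cols)
      (fun _ => isCol_block_cyclePair) h

theorem card_filter_card_eq_of_permEquiv {C C' : Type*} {M : Matrix (Fin 5) C (Fin 2)}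
    {M' : Matrix (Fin 5) C' (Fin 2)} {𝒯 𝒯' : Finset (Finset (Fin 5))}
    (h : ∀ A, IsCol M A ↔ A ∈ 𝒯) (h' : ∀ A, IsCol M' A ↔ A ∈ 𝒯') (hp : PermEquiv M M') (s : ℕ) :
    #{A ∈ 𝒯 | #A = s} = #{A ∈ 𝒯' | #A = s} := by
  obtain ⟨r, hr⟩ := hp.isCol_map
  have : 𝒯' = push r.toEmbedding 𝒯 := by
    ext A
    obtain ⟨B, rfl⟩ : ∃ B, A = B.map r.toEmbedding :=
      ⟨A.map r.symm.toEmbedding, by ext x; simp [mem_map_equiv]⟩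
    rw [map_mem_push, ← h', hr, h]
  rw [this, push, filter_map, card_map]
  simp

/-- The number of columns of sum 2 is a permutation invariant; it is 10, 0 and 5 respectively. -/
theorem blocks_not_permEquiv :
    ¬ PermEquiv (block (K 5 2)) (block (K 5 3)) ∧
      ¬ PermEquiv (block (K 5 2)) (block cyclePair) ∧
      ¬ PermEquiv (block (K 5 3)) (block cyclePair) := by
  refine ⟨fun h => ?_, fun h => ?_, fun h => ?_⟩
  · have := card_filter_card_eq_of_permEquiv (fun _ => isCol_block_K_two)
      (fun _ => isCol_block_K_three) h 2
    revert this
    decide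
  · have := card_filter_card_eq_of_permEquiv (fun _ => isCol_block_K_two)
      (fun _ => isCol_block_cyclePair) h 2
    revert this
    decide
  · have := card_filter_card_eq_of_permEquiv (fun _ => isCol_block_K_three)
      (fun _ => isCol_block_cyclePair) h 2
    revert this
    decide

end Blocks

/-! ### The block construction is simple and avoids the configuration -/

section Construction

variable {t k l : ℕ}

theorem construction_none (B : Fin t → Matrix (Fin k) (Fin l) (Fin 2)) (p : Fin t × Fin k) :
    construction B p none = 1 := rfl

theorem construction_some (B : Fin t → Matrix (Fin k) (Fin l) (Fin 2)) (p : Fin t × Fin k)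
    (i : Fin t) (c : Fin l) : construction B p (some (i, c)) =
      if p.1 = i then B p.1 p.2 c else if p.1 < i then 1 else 0 := rfl

/-- On the rows of block `i`, every column from a later block, and the last column, is all ones,
while no column of `B i` is. -/
theorem isSimple_construction {B : Fin t → Matrix (Fin k) (Fin l) (Fin 2)}
    (hs : ∀ i, IsSimple (B i)) (hfull : ∀ i, ¬ IsCol (B i) univ) : IsSimple (construction B) := by
  have hlt : ∀ i c j, (∀ p, construction B p (some (i, c)) = construction B p j) →
      ¬ ∀ x, construction B (i, x) j = 1 := by
    intro i c j h h'
    refine hfull i ⟨c, fun x => ?_⟩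
    have := (h (i, x)).trans (h' x)
    simpa [construction_some] using this
  rintro (_ | ⟨i, c⟩) (_ | ⟨i', c'⟩) h
  · rfl
  · exact absurd (fun x => rfl) (hlt i' c' none fun p => (h p).symm)
  · exact absurd (fun x => rfl) (hlt i c none h)
  · rcases lt_trichotomy i i' with hi | rfl | hi
    · exact absurd (fun x => by simp [construction_some, hi.ne, hi]) (hlt i c _ h)
    · congr 2
      refine hs i c c' fun x => ?_
      simpa [construction_some] using h (i, x)
    · exact absurd (fun x => by simp [construction_some, hi.ne, hi])
        (hlt i' c' _ fun p => (h p).symm)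

/-- A row of an earlier block dominates every row of a later one, so the two rows of a configuration
share a block. They agree on columns outside that block, so the whole configuration lies in it. -/
theorem not_isConfig_construction {B : Fin t → Matrix (Fin k) (Fin l) (Fin 2)} {p : ℕ} (hp : 0 < p)
    (hB : ∀ i, ¬ IsConfig (F0p10 p) (B i)) : ¬ IsConfig (F0p10 p) (construction B) := by
  rintro ⟨r, c, h⟩
  have h' (a b) : construction B (r a) (c b) = F0p10 p a b := by rw [← h]; rfl
  have hmono : ∀ q q' : Fin t × Fin k, q.1 < q'.1 → ∀ j, construction B q' j = 1 →
      construction B q j = 1 := by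
    rintro q q' hq (_ | ⟨i, x⟩) hj
    · rfl
    · rw [construction_some] at hj ⊢
      split_ifs at hj with h1 h2
      · rw [if_neg (hq.trans_eq h1).ne, if_pos (hq.trans_eq h1)]
      · rw [if_neg (hq.trans h2).ne, if_pos (hq.trans h2)]
      · simp at hj
  have h0 (a) : construction B (r a) (c 0) = if a = 0 then 1 else 0 := by
    rw [h']; simp [F0p10, hp]
  have h1 (a) : construction B (r a) (c (Fin.last p)) = if a = 0 then 0 else 1 := by
    rw [h']; simp [F0p10]
  have hne (b) : construction B (r 0) (c b) ≠ construction B (r 1) (c b) := by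
    rw [h', h']
    simp only [F0p10, Matrix.of_apply]
    split_ifs <;> simp_all
  have heq : (r 0).1 = (r 1).1 := by
    rcases lt_trichotomy (r 0).1 (r 1).1 with hlt | heq | hlt
    · have := hmono _ _ hlt (c (Fin.last p)) (by simp [h1])
      simp [h1] at this
    · exact heq
    · have := hmono _ _ hlt (c 0) (by simp [h0])
      simp [h0] at this
  have hc : ∀ b, ∃ x, c b = some ((r 0).1, x) := by
    intro b
    have := hne b
    rcases hcb : c b with _ | ⟨i, x⟩
    · simp [hcb, construction_none] at this
    · rw [hcb, construction_some, construction_some, ← heq] at this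
      split_ifs at this with h1
      · exact ⟨x, by rw [h1]⟩
      · simp at this
      · simp at this
  choose f hf using hc
  have hr : ∀ a, (r a).1 = (r 0).1 := by
    intro a
    fin_cases a
    · rfl
    · exact heq.symm
  refine hB (r 0).1 ⟨⟨fun a => (r a).2, fun a a' haa => ?_⟩, ⟨f, fun b b' hbb => ?_⟩,
    Matrix.ext fun a b => ?_⟩
  · exact r.injective (Prod.ext ((hr a).trans (hr a').symm) haa)
  · exact c.injective (by rw [hf, hf, hbb])
  · rw [← h', hf, construction_some, if_pos (hr a), hr a]
    rfl

theorem card_construction_cols : Fintype.card (Option (Fin t × Fin l)) = l * t + 1 := by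
  simp [mul_comm]

theorem mem_avoid_of_permEquiv {m n : ℕ} {A : Matrix (Fin m) (Fin n) (Fin 2)}
    {B : Fin t → Matrix (Fin 5) (Fin l) (Fin 2)} (hB : ∀ i, IsBlock (B i))
    (h : PermEquiv A (construction B)) : A ∈ Avoid m n (F0p10 6) :=
  ⟨h.isSimple (isSimple_construction (fun i => (hB i).avoids.1) fun i => (hB i).avoids.2.2),
    fun hc => not_isConfig_construction (by norm_num) (fun i => (hB i).avoids.2.1) (h.isConfig hc)⟩

end Construction

/-! ### From towers back to matrices -/

section Upper

theorem card_le_or_tower_of_mem_avoid {m n : ℕ} {A : Matrix (Fin m) (Fin n) (Fin 2)}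
    (hA : A ∈ Avoid m n (F0p10 6)) : 5 * n ≤ 21 * m ∨ Tower univ (fam A) := by
  have h1 : Balanced (fam A) := by
    by_contra h
    exact hA.2 (hA.1.isConfig_iff.2 h)
  simpa [hA.1.card_fam] using card_le_or_tower univ (fam A) (fun _ _ => subset_univ _) h1

variable {R : Type*} [DecidableEq R]

theorem Tower.exists_matrix {S : Finset R} {𝒜 : Finset (Finset R)} (h : Tower S 𝒜) :
    ∃ (t : ℕ) (e : Fin t × Fin 5 ↪ R), univ.map e = S ∧
      ∃ B : Fin t → Matrix (Fin 5) (Fin 21) (Fin 2), (∀ i, IsBlock (B i)) ∧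
        ∀ A ⊆ S, (A ∈ 𝒜 ↔ ∃ j, ∀ p, e p ∈ A ↔ construction B p j = 1) := by
  induction h with
  | nil =>
    refine ⟨0, ⟨fun p => p.1.elim0, fun p => p.1.elim0⟩, by simp, fun i => i.elim0,
      fun i => i.elim0, fun A hA => ?_⟩
    rw [subset_empty] at hA
    exact iff_of_true (by simp [hA]) ⟨none, fun p => p.1.elim0⟩
  | @cons L 𝒜 e₀ adj hadj hdisj h ih =>
    obtain ⟨t, e, rfl, B, hB, hmem⟩ := ih
    obtain ⟨B₀, hB₀, hcol⟩ := hadj.exists_matrix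
    have hne : ∀ x p, e₀ x ≠ e p := fun x p hxp =>
      disjoint_left.1 hdisj (mem_map_of_mem e₀ (mem_univ x)) (hxp ▸ mem_map_of_mem e (mem_univ p))
    let f : Fin (t + 1) × Fin 5 → R := fun p => Fin.cases (e₀ p.2) (fun i => e (i, p.2)) p.1
    have f0 (x) : f (0, x) = e₀ x := rfl
    have fs (i x) : f (Fin.succ i, x) = e (i, x) := rfl
    have hf : Function.Injective f := by
      rintro ⟨i, x⟩ ⟨i', x'⟩ h
      induction i using Fin.cases <;> induction i' using Fin.cases <;> simp only [f0, fs] at h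
      · rw [e₀.injective h]
      · exact absurd h (hne _ _)
      · exact absurd h.symm (hne _ _)
      · simpa using e.injective h
    -- The newest block gets index 0: its points lie in every set coming from the older blocks,
    -- matching the ones above the diagonal.
    refine ⟨t + 1, ⟨f, hf⟩, ?_, Fin.cons B₀ B, fun i => ?_, fun A hA => ?_⟩
    · ext y
      simp only [mem_map, mem_univ, true_and, mem_union, Function.Embedding.coeFn_mk, Prod.exists,
        Fin.exists_fin_succ, f0, fs]
    · induction i using Fin.cases
      · exact hB₀
      · exact hB _
    · simp only [Function.Embedding.coeFn_mk, Prod.forall, Fin.forall_fin_succ (n := t), f0, fs]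
      rw [Option.exists, Prod.exists, Fin.exists_fin_succ]
      simp only [construction_none, construction_some, Fin.cons_zero, Fin.cons_succ, if_true,
        Fin.succ_ne_zero, (Fin.succ_ne_zero _).symm, if_false, Fin.succ_pos, Fin.not_lt_zero,
        Fin.succ_inj, Fin.succ_lt_succ_iff, iff_true]
      have hz : (0 : Fin 2) ≠ 1 := by decide
      simp only [hz, iff_false]
      rw [mem_union]
      have hlow : A ∈ push e₀ (blockFamily adj) ↔
          ∃ c, (∀ x, e₀ x ∈ A ↔ B₀ x c = 1) ∧ ∀ i x, e (i, x) ∉ A := by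
        rw [mem_push]
        constructor
        · rintro ⟨T, hT, rfl⟩
          obtain ⟨c, hc⟩ := (hcol T).2 hT
          refine ⟨c, fun x => by simpa using hc x, fun i x hx => ?_⟩
          obtain ⟨y, -, hy⟩ := mem_map.1 hx
          exact hne _ _ hy
        · rintro ⟨c, hc, hnot⟩
          refine ⟨univ.filter fun x => e₀ x ∈ A, (hcol _).1 ⟨c, by simpa using hc⟩, ?_⟩
          ext y
          simp only [mem_map, mem_filter, mem_univ, true_and]
          constructor
          · rintro ⟨x, hx, rfl⟩
            exact hx
          · intro hy
            rcases mem_union.1 (hA hy) with h | h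
            · obtain ⟨x, -, rfl⟩ := mem_map.1 h
              exact ⟨x, hy, rfl⟩
            · obtain ⟨p, -, rfl⟩ := mem_map.1 h
              exact absurd hy (hnot p.1 p.2)
      have hhigh : A ∈ 𝒜.image (univ.map e₀ ∪ ·) ↔
          (∀ x, e₀ x ∈ A) ∧ ∃ j, ∀ p, e p ∈ A ↔ construction B p j = 1 := by
        rw [mem_image]
        constructor
        · rintro ⟨A', hA', rfl⟩
          obtain ⟨j, hj⟩ := (hmem A' (h.subset A' hA')).1 hA'
          refine ⟨fun x => by simp, j, fun p => ?_⟩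
          rw [← hj, mem_union, or_iff_right]
          intro hx
          obtain ⟨y, -, hy⟩ := mem_map.1 hx
          exact hne _ _ hy
        · rintro ⟨hx, j, hj⟩
          have hsub : univ.map e₀ ⊆ A := by
            intro y hy
            obtain ⟨x, -, rfl⟩ := mem_map.1 hy
            exact hx x
          refine ⟨A \ univ.map e₀, (hmem _ fun y hy => ?_).2 ⟨j, fun p => ?_⟩,
            union_sdiff_of_subset hsub⟩
          · rw [mem_sdiff] at hy
            exact (mem_union.1 (hA hy.1)).resolve_left hy.2
          · rw [← hj, mem_sdiff, and_iff_left]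
            intro hp
            obtain ⟨y, -, hy⟩ := mem_map.1 hp
            exact hne _ _ hy
      rw [hlow, hhigh]
      simp only [Option.exists, Prod.exists, Prod.forall, construction_none, construction_some,
        iff_true, exists_and_left]
      rw [and_or_left, or_left_comm]

/-- A simple matrix whose columns form a tower is built from blocks. -/
theorem Tower.exists_permEquiv {t n : ℕ} {A : Matrix (Fin (5 * t)) (Fin n) (Fin 2)}
    (hA : IsSimple A) (h : Tower univ (fam A)) :
    ∃ B : Fin t → Matrix (Fin 5) (Fin 21) (Fin 2), (∀ i, IsBlock (B i)) ∧
      PermEquiv A (construction B) := by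
  obtain ⟨t', e, he, B, hB, hmem⟩ := h.exists_matrix
  obtain rfl : t' = t := by
    have := congrArg Finset.card he
    simp at this
    omega
  refine ⟨B, hB, ?_⟩
  have hbij : Function.Bijective e := ⟨e.injective, fun y => by
    have : y ∈ univ.map e := he ▸ mem_univ y
    simpa using this⟩
  refine permEquiv_of_isCol hA
    (isSimple_construction (fun i => (hB i).avoids.1) fun i => (hB i).avoids.2.2)
    (Equiv.ofBijective e hbij).symm fun S => ?_
  rw [← mem_fam, hmem S (subset_univ S)]
  simp only [IsCol, mem_map_equiv, Equiv.symm_symm, Equiv.ofBijective_apply]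

end Upper

/-! ### Lower bound for `m ≡ 1 (mod 5)` -/

section Lower

variable {R : Type*} [DecidableEq R]

/-- Twenty-five subsets of a six-element set. -/
def sixFamily : Finset (Finset (Fin 6)) :=
  (univ.filter fun A => #A = 0 ∨ #A = 1 ∨ #A = 5 ∨ #A = 6) ∪
    -- On the hexagon 0-1-2-3-5-4: its six edges, its two alternating triples, and the complements
    -- of its three long diagonals. Whether `i`, `j` are adjacent, at distance 2 or opposite, these
    -- contribute `1+1+1`, `2+0+1` or `2+1+0` to `sep`; with `{i}` and `{j}ᶜ` the total is 5.
    {{0, 1}, {1, 2}, {2, 3}, {0, 4}, {3, 5}, {4, 5}, {1, 3, 4}, {0, 2, 5}, {0, 2, 3, 4},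
      {0, 1, 3, 5}, {1, 2, 4, 5}}

theorem card_sixFamily : #sixFamily = 25 := by decide

theorem sep_sixFamily : ∀ i j, sep sixFamily i j ≤ 5 := by decide

theorem sep_push_eq_zero {α : Type*} (e : α ↪ R) (𝒯 : Finset (Finset α)) {i : R}
    (hi : i ∉ Set.range e) (j : R) : sep (push e 𝒯) i j = 0 := by
  by_contra h
  obtain ⟨A, hA, hiA, -⟩ := sep_ne_zero.1 h
  obtain ⟨B, -, rfl⟩ := mem_push.1 hA
  obtain ⟨x, -, rfl⟩ := mem_map.1 hiA
  exact hi ⟨x, rfl⟩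

theorem balanced_push {α : Type*} [DecidableEq α] (e : α ↪ R) {𝒯 : Finset (Finset α)}
    (h : ∀ i j, sep 𝒯 i j ≤ 5) : Balanced (push e 𝒯) := by
  intro i j hij
  by_cases hi : i ∈ Set.range e
  · by_cases hj : j ∈ Set.range e
    · obtain ⟨i, rfl⟩ := hi
      obtain ⟨j, rfl⟩ := hj
      rw [sep_push]
      exact h j i
    · rw [sep_push_eq_zero e 𝒯 hj]
      omega
  · exact absurd (sep_push_eq_zero e 𝒯 hi j) hij

/-- Two points of `U` are separated only by `ℬ`, two points outside only by `𝒜`, and a point outside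
is never separated from one of `U`. -/
theorem balanced_stack {U : Finset R} {ℬ 𝒜 : Finset (Finset R)}
    (hℬ : ∀ B ∈ ℬ, B ⊆ U) (hbℬ : Balanced ℬ) (hb𝒜 : Balanced 𝒜) :
    Balanced (stack U ℬ 𝒜) := by
  have hUi : ∀ j ∈ U, ∀ i, sep (stack U ℬ 𝒜) i j ≤ sep ℬ i j := by
    intro j hj i
    refine card_le_card fun A hA => ?_
    rw [mem_filter, stack, mem_union] at hA
    refine mem_filter.2 ⟨hA.1.resolve_right fun h => ?_, hA.2⟩
    obtain ⟨B, -, rfl⟩ := mem_image.1 h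
    exact hA.2.2 (mem_union_left _ hj)
  have hLi : ∀ i ∉ U, ∀ j, sep (stack U ℬ 𝒜) i j ≤ sep 𝒜 i j := by
    intro i hi j
    refine le_trans (card_le_card fun A hA => ?_) (card_image_le (f := (U ∪ ·)))
    rw [mem_filter, stack, mem_union] at hA
    obtain ⟨B, hB, rfl⟩ := mem_image.1 (hA.1.resolve_left fun h => hi (hℬ A h hA.2.1))
    refine mem_image.2 ⟨B, mem_filter.2 ⟨hB, ?_⟩, rfl⟩
    simp only [mem_union, not_or] at hA
    tauto
  have hzero : ∀ i ∉ U, ∀ j, sep ℬ i j = 0 := by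
    intro i hi j
    by_contra h
    obtain ⟨A, hA, hiA, -⟩ := sep_ne_zero.1 h
    exact hi (hℬ A hA hiA)
  intro i j hij
  by_cases hi : i ∈ U <;> by_cases hj : j ∈ U
  · have := hUi j hj i
    exact (hUi i hi j).trans (hbℬ i j (by omega))
  · have := hUi i hi j
    have := hzero j hj i
    omega
  · have := hUi j hj i
    have := hzero i hi j
    omega
  · have := hLi i hi j
    exact (hLi j hj i).trans (hb𝒜 i j (by omega))

/-- The six-point family contains its own full set, so it goes at the bottom, where nothing is
stacked below it. The count `21 * t + 25` is `⌊21m/5⌋` for `m = 5 * t + 6`. -/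
theorem exists_balanced (t : ℕ) (S : Finset R) (hS : #S = 5 * t + 6) :
    ∃ 𝒜 : Finset (Finset R), (∀ A ∈ 𝒜, A ⊆ S) ∧ Balanced 𝒜 ∧ #𝒜 = 21 * t + 25 := by
  induction t generalizing S with
  | zero =>
    obtain ⟨e, rfl⟩ := exists_map_univ_eq hS
    exact ⟨push e sixFamily, push_subset, balanced_push e sep_sixFamily,
      by rw [card_push, card_sixFamily]⟩
  | succ t ih =>
    obtain ⟨U, hUS, hU⟩ := exists_subset_card_eq (show 5 ≤ #S by omega)
    obtain ⟨𝒜, h1, h2, h3⟩ := ih (S \ U) (by rw [card_sdiff_of_subset hUS]; omega)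
    obtain ⟨e, rfl⟩ := exists_map_univ_eq hU
    have hadj : IsBlockAdj fun _ _ => true := Or.inl rfl
    refine ⟨stack (univ.map e) (push e (blockFamily fun _ _ => true)) 𝒜, ?_,
      balanced_stack push_subset (balanced_push e hadj.sep_blockFamily) h2, ?_⟩
    · have := stack_subset (push_subset (e := e) (𝒯 := blockFamily fun _ _ => true)) h1
      rwa [union_sdiff_of_subset hUS] at this
    · rw [card_stack disjoint_sdiff push_subset (hadj.map_univ_notMem e) h1, card_push,
        hadj.card_blockFamily, h3]
      ring

theorem exists_mem_avoid_of_balanced {m : ℕ} {𝒜 : Finset (Finset (Fin m))} (h : Balanced 𝒜) :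
    (Avoid m #𝒜 (F0p10 6)).Nonempty := by
  let c : Fin #𝒜 ≃ 𝒜 := 𝒜.equivFin.symm
  let A : Matrix (Fin m) (Fin #𝒜) (Fin 2) := Matrix.of fun i j => if i ∈ (c j).1 then 1 else 0
  have hA (i j) : A i j = 1 ↔ i ∈ (c j).1 := by simp [A]
  have hs : IsSimple A := by
    intro j j' hj
    refine c.injective (Subtype.ext (Finset.ext fun i => ?_))
    rw [← hA, ← hA, hj]
  have hfam : fam A = 𝒜 := by
    ext S
    simp only [mem_fam, IsCol, hA]
    constructor
    · rintro ⟨j, hj⟩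
      obtain rfl : S = (c j).1 := Finset.ext hj
      exact (c j).2
    · intro hS
      exact ⟨c.symm ⟨S, hS⟩, by simp⟩
  refine ⟨A, hs, fun hc => hs.isConfig_iff.1 hc ?_⟩
  rwa [hfam]

end Lower

/-! ### The values of `forb` and the extremal matrices -/

section Forb

theorem le_forb {m n : ℕ} (h : (Avoid m n (F0p10 6)).Nonempty) : n ≤ forb m (F0p10 6) :=
  (forb_isGreatest m (F0p10 6)).2 h

theorem forb_le (m : ℕ) : 5 * forb m (F0p10 6) ≤ 21 * m + 5 := by
  obtain ⟨A, hA⟩ := (forb_isGreatest m (F0p10 6)).1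
  rcases card_le_or_tower_of_mem_avoid hA with h | h
  · omega
  · have := h.card
    rw [hA.1.card_fam, card_univ, Fintype.card_fin, Fintype.card_fin] at this
    omega

/-- The size identity `Tower.card` makes 5 divide `21 * m`, so no tower exists here. -/
theorem forb_le_of_not_dvd {m : ℕ} (hm : ¬ 5 ∣ m) : 5 * forb m (F0p10 6) ≤ 21 * m := by
  obtain ⟨A, hA⟩ := (forb_isGreatest m (F0p10 6)).1
  rcases card_le_or_tower_of_mem_avoid hA with h | h
  · exact h
  · have := h.card
    rw [hA.1.card_fam, card_univ, Fintype.card_fin, Fintype.card_fin] at this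
    omega

theorem exists_permEquiv_construction {t : ℕ} (B : Fin t → Matrix (Fin 5) (Fin 21) (Fin 2)) :
    ∃ A : Matrix (Fin (5 * t)) (Fin (21 * t + 1)) (Fin 2), PermEquiv A (construction B) :=
  ⟨(construction B).submatrix (Fintype.equivFinOfCardEq (by simp [mul_comm])).symm
    (Fintype.equivFinOfCardEq card_construction_cols).symm, _, _, rfl⟩

theorem forb_five_mul (t : ℕ) : forb (5 * t) (F0p10 6) = 21 * t + 1 := by
  obtain ⟨B, hB, -⟩ := IsBlockAdj.exists_matrix (adj := fun _ _ => true) (Or.inl rfl)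
  obtain ⟨A, hA⟩ := exists_permEquiv_construction fun _ : Fin t => B
  have h1 := le_forb ⟨A, mem_avoid_of_permEquiv (fun _ => hB) hA⟩
  have h2 := forb_le (5 * t)
  omega

theorem floor_eq (m : ℕ) : ⌊(21 / 5 : ℚ) * (m : ℚ)⌋₊ = 21 * m / 5 := by
  have := Nat.floor_div_eq_div (K := ℚ) (21 * m) 5
  rw [← this]
  congr 1
  push_cast
  ring

theorem isExtremal_iff {t n : ℕ} {A : Matrix (Fin (5 * t)) (Fin n) (Fin 2)} :
    IsExtremal (F0p10 6) A ↔ ∃ B : Fin t → Matrix (Fin 5) (Fin 21) (Fin 2),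
      (∀ i, IsBlock (B i)) ∧ PermEquiv A (construction B) := by
  rw [IsExtremal, forb_five_mul]
  constructor
  · rintro ⟨hA, rfl⟩
    -- With `21 * t + 1` columns the first alternative, `5 * n ≤ 21 * m`, is impossible.
    rcases card_le_or_tower_of_mem_avoid hA with h | h
    · omega
    · exact h.exists_permEquiv hA.1
  · rintro ⟨B, hB, h⟩
    refine ⟨mem_avoid_of_permEquiv hB h, ?_⟩
    obtain ⟨-, c, -⟩ := h
    rw [← card_construction_cols, ← Fintype.card_congr c, Fintype.card_fin]

end Forb

end ForbConf

open ForbConf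
theorem mainTheorem2 :
    (∀ m : ℕ, forb m (F0p10 6) ≤ ⌊(21 / 5 : ℚ) * (m : ℚ)⌋₊ + 1) ∧
    (∀ m : ℕ, forb m (F0p10 6) = ⌊(21 / 5 : ℚ) * (m : ℚ)⌋₊ + 1 ↔ m ≡ 0 [MOD 5]) ∧
    (∀ m : ℕ, m ≡ 1 [MOD 5] → 6 ≤ m → forb m (F0p10 6) = ⌊(21 / 5 : ℚ) * (m : ℚ)⌋₊) ∧
    -- the three blocks are pairwise different
    (¬ PermEquiv (block (K 5 2)) (block (K 5 3)) ∧
      ¬ PermEquiv (block (K 5 2)) (block cyclePair) ∧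
      ¬ PermEquiv (block (K 5 3)) (block cyclePair)) ∧
    -- the extremal matrices, up to row and column permutations, on `m = 5 t` rows
    (∀ (t n : ℕ) (A : Matrix (Fin (5 * t)) (Fin n) (Fin 2)),
      IsExtremal (F0p10 6) A ↔
        ∃ B : Fin t → Matrix (Fin 5) (Fin 21) (Fin 2),
          (∀ i, PermEquiv (B i) (block (K 5 2)) ∨ PermEquiv (B i) (block (K 5 3)) ∨
            PermEquiv (B i) (block cyclePair)) ∧
          PermEquiv A (construction B)) := by
  simp only [floor_eq]
  refine ⟨fun m => ?_, fun m => ?_, fun m hm h6 => ?_, blocks_not_permEquiv,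
    fun t n A => isExtremal_iff⟩
  · have := forb_le m
    omega
  · rw [Nat.modEq_zero_iff_dvd]
    constructor
    · intro h
      by_contra hm
      have := forb_le_of_not_dvd hm
      omega
    · rintro ⟨t, rfl⟩
      rw [forb_five_mul]
      omega
  · have hm' : m % 5 = 1 := hm
    obtain ⟨t, rfl⟩ : ∃ t, m = 5 * t + 6 := ⟨(m - 6) / 5, by omega⟩
    obtain ⟨𝒜, -, hbal, hcard⟩ := exists_balanced t (Finset.univ : Finset (Fin (5 * t + 6))) (by simp)
    have h1 := le_forb (exists_mem_avoid_of_balanced hbal)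
    have h2 := forb_le_of_not_dvd (m := 5 * t + 6) (by omega)
    omega
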